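/- **Conventions.** Digraphs are labelled, without loops and multiple arcs (so there are $2^{n(n-1)}$ digraphs on $n$ vertices); the empty digraph has no strong component and is not strongly connected. For real $\alpha>1$ and an integer $\beta\ge 1$, let $\mathfrak{G}_\alpha^\beta$ be the ring of graphically divergent series: formal power series $A(z)=\sum_{n\ge0} a_n z^n/n!$ such that, for some $M\in\mathbb Z$ and reals $a^\circ_{m,\ell}$ (for each $m$ only finitely many of them nonzero), as $n\to\infty$, $$a_n\approx \alpha^{\beta\binom n2}\sum_{m\ge M}\alpha^{-mn}\sum_{\ell\ge0} n^{\underline{\ell}}\,a^\circ_{m,\ell},$$ meaning that for every integer $R$ the difference between $a_n\alpha^{-\beta\binom n2}$ and the partial sum over $M\le m\le R$ is $o(\alpha^{-Rn})$. The Coefficient GF of $A$ (which is unique) is $$(\mathcal Q_\alpha^\beta A)(z,w)=\sum_{m\ge M}\sum_{\ell\ge0}\frac{a^\circ_{m,\ell}}{\alpha^{\frac1\beta\binom m2}}z^mw^\ell .$$ Let $\odot_z$ be the exponential Hadamard product in $z$, $\big(\sum_n a_n \frac{z^n}{n!}\big)\odot_z\big(\sum_n b_n \frac{z^n}{n!}\big)=\sum_n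 a_nb_n \frac{z^n}{n!}$ (the $a_n$ may depend on $w$), let $\widehat{\mathsf{Set}}(z,u)=\sum_n (1+u)^{-\binom n2}\frac{z^n}{n!}$ and $\widehat{\mathsf{Set}}(z)=\widehat{\mathsf{Set}}(z,1)$. Let $\mathsf{SCD}(z)=\sum_n \mathfrak{s}_n\frac{z^n}{n!}$ and $\widehat{\mathsf{SCD}}(z)=\sum_n \mathfrak{s}_n2^{-\binom n2}\frac{z^n}{n!}$, where $\mathfrak{s}_n$ is the number of strongly connected digraphs on $n$ labelled vertices, and let $\widehat S_k(z)=\sum_n d_{n,k}2^{-\binom n2}\frac{z^n}{n!}$, where $d_{n,k}$ is the number of digraphs on $n$ labelled vertices with exactly $k$ strong components. **Proposition.** The series $\mathsf{SCD}$ belongs to $\mathfrak{G}_2^2$; write $S^\circ(z,w)=(\mathcal Q_2^2\,\mathsf{SCD})(z,w)$. The series $\widehat S_2$ and $\widehat S_3$ belong to $\mathfrak{G}_2^1$, and $$(\mathcal Q_2^1\widehat S_2)(z,w)=2\,\widehat{\mathsf{SCD}}(2zw)\big(S^\circ(z,w)\odot_z\widehat{\mathsf{Set}}(z,\sqrt2-1)\big)-\big(\mathsf{SCD}(2^{3/2}z^2w)\,S^\circ(z,w)\big)\odot_z\widehat{\mathsf{Set}}(z,\sqrt2-1),$$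 $$\begin{aligned}(\mathcal Q_2^1\widehat S_3)(z,w)={}&3\,\widehat{\mathsf{SCD}}(2zw)^2\big(S^\circ(z,w)\odot_z\widehat{\mathsf{Set}}(z,\sqrt2-1)\big)\\&-\big(S^\circ(z,w)\odot_z\widehat{\mathsf{Set}}(z,\sqrt2-1)\big)\big(\mathsf{SCD}(2zw)^2\odot_z\widehat{\mathsf{Set}}(z)\big)\\&-\widehat{\mathsf{SCD}}(2zw)\Big[\big(2\,\mathsf{SCD}(2^{3/2}z^2w)\,S^\circ(z,w)\big)\odot_z\widehat{\mathsf{Set}}(z,\sqrt2-1)\Big]\\&+\tfrac12\big(\mathsf{SCD}(2^{3/2}z^2w)^2\,S^\circ(z,w)\big)\odot_z\widehat{\mathsf{Set}}(z,\sqrt2-1).\end{aligned}$$ Moreover, as $n\to\infty$, the probability that a uniformly random digraph on $n$ labelled vertices has exactly $2$ strong components is asymptotically equivalent to $4n2^{-n}$, and the probability that it has exactly $3$ is asymptotically equivalent to $20\,n(n-1)\,2^{-2n}$. -/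

import Mathlib

open Polynomial PowerSeries LaurentSeries Filter Asymptotics

noncomputable section

namespace DenseDigraph

/-! ### Digraphs and their strong components -/

/-- Digraphs without loops (and without multiple arcs) on the vertex set `V`. -/
abbrev LooplessDigraph (V : Type*) : Type _ := {D : Digraph V // ∀ v, ¬ D.Adj v v}

/-- There is a directed path (possibly of length zero) from `u` to `v`. -/
def Reaches {V : Type*} (D : LooplessDigraph V) (u v : V) : Prop :=
  Relation.ReflTransGen D.1.Adj u v

/-- Mutual reachability; its classes are the strong components. -/
def strongSetoid {V : Type*} (D : LooplessDigraph V) : Setoid V where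
  r u v := Reaches D u v ∧ Reaches D v u
  iseqv :=
    { refl := fun _ => ⟨Relation.ReflTransGen.refl, Relation.ReflTransGen.refl⟩
      symm := fun h => ⟨h.2, h.1⟩
      trans := fun h k => ⟨Relation.ReflTransGen.trans h.1 k.1,
        Relation.ReflTransGen.trans k.2 h.2⟩ }

/-- The number of strong components of a digraph. -/
def numStrongComponents {V : Type*} (D : LooplessDigraph V) : ℕ :=
  Nat.card (Quotient (strongSetoid D))

/-- A digraph is strongly connected if it is nonempty and every vertex can be reached from every
other one. -/
def IsStronglyConnected {V : Type*} (D : LooplessDigraph V) : Prop :=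
  Nonempty V ∧ ∀ u v, Reaches D u v

/-- The number of digraphs with vertex set `{1, …, n}`. -/
def digraphCount (n : ℕ) : ℕ := Nat.card (LooplessDigraph (Fin n))

/-- The number of strongly connected digraphs with vertex set `{1, …, n}`. -/
def strongCount (n : ℕ) : ℕ :=
  Nat.card {D : LooplessDigraph (Fin n) // IsStronglyConnected D}

/-- The number of digraphs with vertex set `{1, …, n}` and exactly `k` strong components. -/
def componentCount (k n : ℕ) : ℕ :=
  Nat.card {D : LooplessDigraph (Fin n) // numStrongComponents D = k}

/-- The probability that a uniformly random digraph on `n` labelled vertices has exactly `k` strong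
components. -/
def componentProbability (k n : ℕ) : ℝ := (componentCount k n : ℝ) / (digraphCount n : ℝ)

/-! ### Exponential and graphic generating functions -/

/-- The exponential generating function `∑ aₙ zⁿ / n!`. -/
def expGF (a : ℕ → ℕ) : ℝ⟦X⟧ := PowerSeries.mk fun n => (a n : ℝ) / (n.factorial : ℝ)

/-- The graphic generating function `∑ aₙ 2^(-n(n-1)/2) zⁿ / n!`. -/
def graphicGF (a : ℕ → ℕ) : ℝ⟦X⟧ :=
  PowerSeries.mk fun n => (a n : ℝ) / (2 : ℝ) ^ (n.choose 2) / (n.factorial : ℝ)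

/-- The graphic generating function of sets, `∑ (1 + w)^(-n(n-1)/2) zⁿ / n!`, at the real value `w`
of its second argument. -/
def graphicSet (w : ℝ) : ℝ⟦X⟧ :=
  PowerSeries.mk fun n => 1 / (1 + w) ^ (n.choose 2) / (n.factorial : ℝ)

/-- `SCD(z)`: exponential generating function of strongly connected digraphs. -/
def SCD : ℝ⟦X⟧ := expGF strongCount

/-- Graphic generating function of strongly connected digraphs. -/
def SCDHat : ℝ⟦X⟧ := graphicGF strongCount

/-- Graphic generating function of digraphs with exactly `k` strong components. -/
def SHat (k : ℕ) : ℝ⟦X⟧ := graphicGF (componentCount k)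

/-! ### Bivariate series

A series `∑_{m ≥ M} z^m P_m(w)`, with `M ∈ ℤ` and polynomials `P_m`, is a Laurent series in `z` over
the ring of real polynomials in `w`. -/

/-- The bivariate series `A(c z^k w)`. -/
def substMonomial (A : ℝ⟦X⟧) (c : ℝ) (k : ℕ) : ℝ[X]⸨X⸩ :=
  HahnSeries.ofPowerSeries ℤ ℝ[X]
    (PowerSeries.subst (PowerSeries.monomial k (Polynomial.C c * Polynomial.X) : ℝ[X]⟦X⟧) A)

/-- The exponential Hadamard product in `z` of a bivariate series `F(z, w)` with
`B(z) = ∑ bₙ zⁿ / n!`: the coefficient of `z^m` in `F` is multiplied by `b_m`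
(which is zero for `m < 0`). -/
def hadamardZ (F : ℝ[X]⸨X⸩) (B : ℝ⟦X⟧) : ℝ[X]⸨X⸩ :=
  HahnSeries.ofPowerSeries ℤ ℝ[X] (PowerSeries.mk fun m =>
    ((m.factorial : ℝ) * PowerSeries.coeff m B) • F.coeff (m : ℤ))

/-! ### Graphically divergent series and their coefficient generating functions -/

/-- For `P(w) = ∑ c_l w^l`, the value `∑ c_l n(n-1)⋯(n-l+1)`. -/
def fallingEval (P : ℝ[X]) (n : ℕ) : ℝ := P.sum fun l c => c * (n.descFactorial l : ℝ)

/-- The order-`m` term of the expansion encoded by `F = ∑ z^m w^l f_{m,l}`, namely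
`α^(-mn) ∑_l n(n-1)⋯(n-l+1) a_{m,l}` where `f_{m,l} = a_{m,l} / α^(m(m-1)/(2β))`. -/
def expansionTerm (α : ℝ) (β : ℕ) (F : ℝ[X]⸨X⸩) (m : ℤ) (n : ℕ) : ℝ :=
  α ^ (-(m * (n : ℤ))) * (α ^ ((m : ℝ) * ((m : ℝ) - 1) / 2 / (β : ℝ)) *
    fallingEval (F.coeff m) n)

/-- `F(z, w)` is a coefficient generating function of type `(α, β)` of `A(z) = ∑ aₙ zⁿ / n!`: there
is an asymptotic expansion
`aₙ ≈ α^(β n(n-1)/2) ∑_{m ≥ M} α^(-mn) ∑_l n(n-1)⋯(n-l+1) a_{m,l}` as `n → ∞`,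
with finitely many nonzero `a_{m,l}` for each `m`, and
`F(z, w) = ∑_{m ≥ M} ∑_l a_{m,l} α^(-m(m-1)/(2β)) z^m w^l`. -/
def IsCoefficientGF (α : ℝ) (β : ℕ) (A : ℝ⟦X⟧) (F : ℝ[X]⸨X⸩) : Prop :=
  ∀ R : ℤ,
    (fun n : ℕ => ((n.factorial : ℝ) * PowerSeries.coeff n A) / α ^ (β * n.choose 2) -
        ∑ m ∈ Finset.Icc F.order R, expansionTerm α β F m n)
      =o[atTop] fun n : ℕ => α ^ (-(R * (n : ℤ)))

/-- The ring of graphically divergent series of type `(α, β)` (as a set of power series): those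
whose coefficients have an asymptotic expansion as in `IsCoefficientGF`. -/
def graphicallyDivergent (α : ℝ) (β : ℕ) : Set ℝ⟦X⟧ := {A | ∃ F, IsCoefficientGF α β A F}

open Classical in
/-- The transform `𝒬` taking a graphically divergent series of type `(α, β)` to its coefficient
generating function, which is unique by `IsCoefficientGF.unique`. -/
def coefficientGF (α : ℝ) (β : ℕ) (A : ℝ⟦X⟧) : ℝ[X]⸨X⸩ :=
  if h : ∃ F, IsCoefficientGF α β A F then h.choose else 0

/-! ### The coefficient generating function is well defined -/

theorem fallingEval_eq_eval (P : ℝ[X]) (n : ℕ) :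
    fallingEval P n = (P.sum fun l c => Polynomial.C c * descPochhammer ℝ l).eval (n : ℝ) := by
  simp [fallingEval, Polynomial.sum, Polynomial.eval_finsetSum,
    descPochhammer_eval_eq_descFactorial]

theorem fallingEval_sub (P Q : ℝ[X]) (n : ℕ) :
    fallingEval (P - Q) n = fallingEval P n - fallingEval Q n := by
  unfold fallingEval
  rw [Polynomial.sum_over_range' (P - Q) (by simp) (max P.natDegree Q.natDegree + 1)
      (Nat.lt_succ_of_le (Polynomial.natDegree_sub_le P Q)),
    Polynomial.sum_over_range' P (by simp) (max P.natDegree Q.natDegree + 1)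
      (Nat.lt_succ_of_le (le_max_left _ _)),
    Polynomial.sum_over_range' Q (by simp) (max P.natDegree Q.natDegree + 1)
      (Nat.lt_succ_of_le (le_max_right _ _)), ← Finset.sum_sub_distrib]
  refine Finset.sum_congr rfl fun l _ => ?_
  rw [Polynomial.coeff_sub]
  ring

theorem eq_zero_of_fallingEval_tendsto {P : ℝ[X]}
    (h : Tendsto (fallingEval P) atTop (nhds 0)) : P = 0 := by
  by_contra hP
  set T : ℝ[X] := P.sum fun l c => Polynomial.C c * descPochhammer ℝ l with hT
  have hco : T.coeff P.natDegree = P.leadingCoeff := by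
    rw [hT, Polynomial.sum, Polynomial.finsetSum_coeff,
      Finset.sum_eq_single P.natDegree]
    · have : (descPochhammer ℝ P.natDegree).coeff P.natDegree = 1 := by
        have := (monic_descPochhammer ℝ P.natDegree).coeff_natDegree
        rwa [descPochhammer_natDegree] at this
      simp [this]
    · intro l hl hne
      have hlt : l < P.natDegree :=
        lt_of_le_of_ne (Polynomial.le_natDegree_of_mem_supp l hl) hne
      have h0 : (descPochhammer ℝ l).coeff P.natDegree = 0 :=
        Polynomial.coeff_eq_zero_of_natDegree_lt (by rwa [descPochhammer_natDegree])
      rw [Polynomial.coeff_C_mul, h0, mul_zero]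
    · intro hn
      simp [hP] at hn
  have hT0 : T ≠ 0 := by
    intro h0
    rw [h0, Polynomial.coeff_zero] at hco
    exact hP (Polynomial.leadingCoeff_eq_zero.mp hco.symm)
  have hev : Tendsto (fun n : ℕ => T.eval (n : ℝ)) atTop (nhds 0) := by
    refine h.congr fun n => ?_
    rw [fallingEval_eq_eval]
  rcases lt_or_ge 0 T.degree with hd | hd
  · have h1 := (T.abs_tendsto_atTop hd).comp tendsto_natCast_atTop_atTop
    have h2 := hev.abs
    exact not_tendsto_nhds_of_tendsto_atTop h1 _ h2
  · rw [Polynomial.eq_C_of_degree_le_zero hd] at hev hT0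
    simp only [Polynomial.eval_C] at hev
    have := tendsto_nhds_unique hev tendsto_const_nhds
    rw [← this] at hT0
    simp at hT0

theorem sum_expansionTerm (α : ℝ) (β : ℕ) (F : ℝ[X]⸨X⸩) {M : ℤ} (hM : M ≤ F.order) (R : ℤ)
    (n : ℕ) : ∑ m ∈ Finset.Icc F.order R, expansionTerm α β F m n =
      ∑ m ∈ Finset.Icc M R, expansionTerm α β F m n := by
  refine Finset.sum_subset (Finset.Icc_subset_Icc_left hM) fun m hm hm' => ?_
  have : m < F.order := by
    simp only [Finset.mem_Icc] at hm hm'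
    lia
  simp [expansionTerm, HahnSeries.coeff_eq_zero_of_lt_order this, fallingEval]

theorem IsCoefficientGF.unique {α : ℝ} (hα : 1 < α) {β : ℕ} {A : ℝ⟦X⟧} {F G : ℝ[X]⸨X⸩}
    (hF : IsCoefficientGF α β A F) (hG : IsCoefficientGF α β A G) : F = G := by
  by_contra hne
  have hD : F - G ≠ 0 := sub_ne_zero.mpr hne
  set R : ℤ := (F - G).order with hR
  set M : ℤ := min R (min F.order G.order) with hM
  have key : ∀ n : ℕ, ((((n.factorial : ℝ) * PowerSeries.coeff n A) / α ^ (β * n.choose 2) -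
        ∑ m ∈ Finset.Icc G.order R, expansionTerm α β G m n) -
      (((n.factorial : ℝ) * PowerSeries.coeff n A) / α ^ (β * n.choose 2) -
        ∑ m ∈ Finset.Icc F.order R, expansionTerm α β F m n)) =
      α ^ (-(R * (n : ℤ))) * (α ^ ((R : ℝ) * ((R : ℝ) - 1) / 2 / (β : ℝ)) *
        fallingEval ((F - G).coeff R) n) := by
    intro n
    rw [sum_expansionTerm α β F (M := M) (by simp [hM]),
      sum_expansionTerm α β G (M := M) (by simp [hM]), sub_sub_sub_cancel_left,
      ← Finset.sum_sub_distrib, Finset.sum_eq_single R]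
    · simp only [expansionTerm, HahnSeries.coeff_sub, fallingEval_sub]
      ring
    · intro m hm hmR
      have hlt : m < (F - G).order := lt_of_le_of_ne (Finset.mem_Icc.mp hm).2 hmR
      have h0 := HahnSeries.coeff_eq_zero_of_lt_order hlt
      rw [HahnSeries.coeff_sub, sub_eq_zero] at h0
      simp [expansionTerm, h0]
    · intro hn
      simp [hM] at hn
  have hlo := (hG R).sub (hF R)
  simp only [key] at hlo
  have hα0 : (0 : ℝ) < α := by linarith
  have ht := hlo.tendsto_div_nhds_zero
  have ht2 : Tendsto (fun n : ℕ => α ^ ((R : ℝ) * ((R : ℝ) - 1) / 2 / (β : ℝ)) *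
      fallingEval ((F - G).coeff R) n) atTop (nhds 0) := by
    refine ht.congr fun n => ?_
    rw [mul_div_cancel_left₀]
    exact (zpow_pos hα0 _).ne'
  set c : ℝ := α ^ ((R : ℝ) * ((R : ℝ) - 1) / 2 / (β : ℝ)) with hc
  have hc0 : c ≠ 0 := (Real.rpow_pos_of_pos hα0 _).ne'
  have ht3 : Tendsto (fallingEval ((F - G).coeff R)) atTop (nhds 0) := by
    have := ht2.const_mul c⁻¹
    rw [mul_zero] at this
    exact this.congr fun n => by rw [inv_mul_cancel_left₀ hc0]
  exact hD (HahnSeries.coeff_order_eq_zero.mp (eq_zero_of_fallingEval_tendsto ht3))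

theorem coefficientGF_eq_iff {α : ℝ} (hα : 1 < α) {β : ℕ} {A : ℝ⟦X⟧}
    (hA : A ∈ graphicallyDivergent α β) {F : ℝ[X]⸨X⸩} :
    coefficientGF α β A = F ↔ IsCoefficientGF α β A F := by
  have h : ∃ F, IsCoefficientGF α β A F := hA
  have hs : IsCoefficientGF α β A (coefficientGF α β A) := by
    rw [coefficientGF, dif_pos h]
    exact h.choose_spec
  exact ⟨fun e => e ▸ hs, fun hF => hs.unique hα hF⟩

end DenseDigraph

end

open DenseDigraph

/-!
Every vertex of a finite digraph is reached from a source component, and toggling one fixed source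
component is a sign-reversing involution on the unions of source components. Hence, if digraphs `D`
are weighted by `u ^ (number of strong components)` and pairs of `D` with a union `X` of source
components by the further sign `(-1) ^ (number of components in X)`, the total weight over each
nonempty vertex set vanishes (`sum_isSourceUnion_eq_zero`). Cutting `D` into `X` and its complement
turns this into an identity of graphic generating functions: that of digraphs is the inverse of that
of disjoint unions of strongly connected digraphs with weight `-u` per component
(`sum_choose_strongUnionSum_mul_digraphSum`). Marking a vertex shows that the exponential generating
function `E` of the latter satisfies `θE = -u θ(SCD) E` for `θ = z d/dz`
(`natCast_mul_strongUnionSum`), that is, `E = exp(-u SCD)`. The coefficients of `u ^ 2` and `u ^ 3`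
express `SHat 2` and `SHat 3` through `SCD` and `SCDHat` (`SHat_two`, `SHat_three`), and `u = 1`
relates `SCD` to the exponential generating function of undirected graphs.

On the analytic side, in a binomial convolution `∑ C(n,k) y_k z_(n-k)` of two sequences that grow
like `α ^ (β n(n-1)/2)` only boundedly many terms at either end matter to a given order
(`exists_isSmall_binomConv_sub`), because `C(n,2) = C(k,2) + C(n-k,2) + k(n-k)`. The term of index
`k` at one end shifts the expansion of `z`, which on the level of the coefficient generating function
is multiplication by `(α ^ ((β+1)/2) z ^ β w) ^ k / k!` (`HasExpansionTo.shift`). This gives the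
product rule `𝒬(AB) = A(⋯) 𝒬B + B(⋯) 𝒬A` (`HasExpansion.mul`). The same estimate, read as a
recurrence, gives the quotient rule (`HasExpansion.of_mul_eq`): if a quotient has at most the expected
growth, its expansion can be determined order by order.

The expansion of `SCD` follows from that of graphs, whose coefficient generating function is `1`: the
quotient rule handles the inverse series, a Hadamard product passes from type `(2, 1)` to type
`(2, 2)`, and the quotient rule applied to `θ(SCD) = -θE / E` replaces a logarithm; the operation on
expansions that corresponds to `θ` can be undone (`hasExpansion_SCD`). The formulas for `SHat 2` and
`SHat 3` are then instances of the product rule. Only `𝒬 SCD = 1 + O(z)` is needed to read off their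
first nonzero coefficients `4zw` and `10 z²w²`, which are the two probability asymptotics.
-/

noncomputable section

namespace DenseDigraph

/-! ### Splitting a digraph along an initial set of vertices -/

open Classical in
instance {V : Type*} [Finite V] : Fintype (LooplessDigraph V) :=
  have : Finite (LooplessDigraph V) :=
    Finite.of_injective (fun D : LooplessDigraph V => D.1.Adj) fun _ _ h =>
      Subtype.ext (Digraph.ext h)
  Fintype.ofFinite _

/-- The subdigraph induced on a set of vertices. -/
def induce {V : Type*} (D : LooplessDigraph V) (X : Set V) : LooplessDigraph X :=
  ⟨⟨fun a b => D.1.Adj a b⟩, fun v => D.2 v⟩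

/-- A digraph amounts to its two induced subdigraphs on `X` and on the complement of `X`, together
with the set of arcs leaving `X` and the set of arcs entering `X`. -/
def splitEquiv {V : Type*} (X : Set V) :
    LooplessDigraph V ≃ (LooplessDigraph X × LooplessDigraph ↥Xᶜ) ×
      (Set (X × ↥Xᶜ) × Set (↥Xᶜ × X)) where
  toFun D := ((induce D X, induce D Xᶜ), ({p | D.1.Adj p.1 p.2}, {p | D.1.Adj p.1 p.2}))
  invFun p := ⟨⟨fun a b =>
    (∃ (ha : a ∈ X) (hb : b ∈ X), p.1.1.1.Adj ⟨a, ha⟩ ⟨b, hb⟩) ∨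
    (∃ (ha : a ∈ Xᶜ) (hb : b ∈ Xᶜ), p.1.2.1.Adj ⟨a, ha⟩ ⟨b, hb⟩) ∨
    (∃ (ha : a ∈ X) (hb : b ∈ Xᶜ), (⟨a, ha⟩, ⟨b, hb⟩) ∈ p.2.1) ∨
    (∃ (ha : a ∈ Xᶜ) (hb : b ∈ X), (⟨a, ha⟩, ⟨b, hb⟩) ∈ p.2.2)⟩, by
    rintro v (⟨_, _, h⟩ | ⟨_, _, h⟩ | ⟨h, h', _⟩ | ⟨h, h', _⟩)
    · exact p.1.1.2 _ h
    · exact p.1.2.2 _ h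
    · exact h' h
    · exact h h'⟩
  left_inv D := by
    refine Subtype.ext (Digraph.ext ?_)
    ext a b
    by_cases ha : a ∈ X <;> by_cases hb : b ∈ X <;> simp [ha, hb, induce]
  right_inv p := by
    obtain ⟨⟨D, E⟩, S, T⟩ := p
    refine Prod.ext (Prod.ext (Subtype.ext (Digraph.ext ?_)) (Subtype.ext (Digraph.ext ?_)))
      (Prod.ext ?_ ?_)
    · ext ⟨a, ha⟩ ⟨b, hb⟩
      simp [induce]
    · ext ⟨a, ha⟩ ⟨b, hb⟩
      have ha' : a ∉ X := ha
      have hb' : b ∉ X := hb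
      simp [ha', hb', induce]
    · ext ⟨⟨a, ha⟩, ⟨b, hb⟩⟩
      have hb' : b ∉ X := hb
      simp [hb']
    · ext ⟨⟨a, ha⟩, ⟨b, hb⟩⟩
      have ha' : a ∉ X := ha
      simp [ha']

/-- No arc enters `X` from outside. -/
def IsInitial {V : Type*} (D : LooplessDigraph V) (X : Set V) : Prop :=
  ∀ a b, D.1.Adj a b → b ∈ X → a ∈ X

theorem isInitial_iff {V : Type*} {D : LooplessDigraph V} {X : Set V} :
    IsInitial D X ↔ (splitEquiv X D).2.2 = ∅ := by
  rw [Set.eq_empty_iff_forall_notMem]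
  refine ⟨fun h p hp => p.1.2 (h _ _ hp p.2.2), fun h a b hab hb => ?_⟩
  by_contra ha
  exact h (⟨a, ha⟩, ⟨b, hb⟩) hab

theorem isInitial_compl_iff {V : Type*} {D : LooplessDigraph V} {X : Set V} :
    IsInitial D Xᶜ ↔ (splitEquiv X D).2.1 = ∅ := by
  rw [Set.eq_empty_iff_forall_notMem]
  refine ⟨fun h p hp => h _ _ hp p.2.2 p.1.2, fun h a b hab hb ha => ?_⟩
  exact h (⟨a, ha⟩, ⟨b, hb⟩) hab

open Classical in
/-- Digraphs in which `X` is initial are independent choices of the two induced subdigraphs and of the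
arcs leaving `X`. -/
theorem sum_isInitial {V R : Type*} [Finite V] [CommRing R] (X : Set V)
    (φ : LooplessDigraph X → R) (ψ : LooplessDigraph ↥Xᶜ → R) :
    ∑ D : LooplessDigraph V, (if IsInitial D X then φ (induce D X) * ψ (induce D Xᶜ) else 0) =
      2 ^ (X.ncard * Xᶜ.ncard) * ((∑ D, φ D) * ∑ D, ψ D) := by
  have := Fintype.ofFinite V
  rw [← (splitEquiv X).symm.sum_comp
    (fun D => if IsInitial D X then φ (induce D X) * ψ (induce D Xᶜ) else 0)]
  have h : ∀ p, (if IsInitial ((splitEquiv X).symm p) X then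
      φ (induce ((splitEquiv X).symm p) X) * ψ (induce ((splitEquiv X).symm p) Xᶜ) else 0) =
      (φ p.1.1 * ψ p.1.2) * (if p.2.2 = ∅ then 1 else 0) := by
    intro p
    have h1 : induce ((splitEquiv X).symm p) X = p.1.1 :=
      congrArg (fun q => q.1.1) ((splitEquiv X).apply_symm_apply p)
    have h2 : induce ((splitEquiv X).symm p) Xᶜ = p.1.2 :=
      congrArg (fun q => q.1.2) ((splitEquiv X).apply_symm_apply p)
    rw [h1, h2, isInitial_iff, Equiv.apply_symm_apply]
    simp
  simp_rw [h]
  rw [Fintype.sum_prod_type, Fintype.sum_prod_type, Finset.sum_mul_sum, Finset.mul_sum]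
  refine Finset.sum_congr rfl fun D _ => ?_
  rw [Finset.mul_sum]
  refine Finset.sum_congr rfl fun E _ => ?_
  dsimp only
  rw [← Finset.mul_sum, Fintype.sum_prod_type, mul_comm]
  have h1 (Y : Set V) : Y.ncard = Fintype.card Y := by
    rw [← Nat.card_coe_set_eq, Nat.card_eq_fintype_card]
  rw [h1, h1]
  congr 1
  simp

open Classical in
/-- Digraphs without arcs between `X` and its complement are independent choices of the two induced
subdigraphs. -/
theorem sum_separated {V R : Type*} [Finite V] [CommRing R] (X : Set V)
    (φ : LooplessDigraph X → R) (ψ : LooplessDigraph ↥Xᶜ → R) :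
    ∑ D : LooplessDigraph V, (if IsInitial D X ∧ IsInitial D Xᶜ then
      φ (induce D X) * ψ (induce D Xᶜ) else 0) = (∑ D, φ D) * ∑ D, ψ D := by
  have := Fintype.ofFinite V
  rw [← (splitEquiv X).symm.sum_comp
    (fun D => if IsInitial D X ∧ IsInitial D Xᶜ then φ (induce D X) * ψ (induce D Xᶜ) else 0)]
  have h : ∀ p, (if IsInitial ((splitEquiv X).symm p) X ∧ IsInitial ((splitEquiv X).symm p) Xᶜ then
      φ (induce ((splitEquiv X).symm p) X) * ψ (induce ((splitEquiv X).symm p) Xᶜ) else 0) =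
      (φ p.1.1 * ψ p.1.2) * (if p.2 = (∅, ∅) then 1 else 0) := by
    intro p
    have h1 : induce ((splitEquiv X).symm p) X = p.1.1 :=
      congrArg (fun q => q.1.1) ((splitEquiv X).apply_symm_apply p)
    have h2 : induce ((splitEquiv X).symm p) Xᶜ = p.1.2 :=
      congrArg (fun q => q.1.2) ((splitEquiv X).apply_symm_apply p)
    rw [h1, h2, isInitial_iff, isInitial_compl_iff, Equiv.apply_symm_apply]
    simp [Prod.ext_iff, and_comm]
  simp_rw [h]
  rw [Fintype.sum_prod_type, Fintype.sum_prod_type, Finset.sum_mul_sum]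
  refine Finset.sum_congr rfl fun D _ => Finset.sum_congr rfl fun E _ => ?_
  dsimp only
  rw [← Finset.mul_sum]
  simp

/-! ### Reachability and unions of source components -/

theorem Reaches.mem {V : Type*} {D : LooplessDigraph V} {X : Set V} (hX : IsInitial D X) {a b : V}
    (h : Reaches D a b) (hb : b ∈ X) : a ∈ X := by
  induction h using Relation.ReflTransGen.head_induction_on with
  | refl => exact hb
  | head hab _ ih => exact hX _ _ hab ih

theorem Reaches.of_induce {V : Type*} {D : LooplessDigraph V} {X : Set V} {a b : X}
    (h : Reaches (induce D X) a b) : Reaches D a b :=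
  Relation.ReflTransGen.lift (r := (induce D X).1.Adj) (p := D.1.Adj) Subtype.val
    (fun _ _ h => h) _ _ h

theorem reaches_induce_iff {V : Type*} {D : LooplessDigraph V} {X : Set V} (hX : IsInitial D X)
    {a b : X} : Reaches (induce D X) a b ↔ Reaches D a b := by
  refine ⟨Reaches.of_induce, fun h => ?_⟩
  obtain ⟨b, hb⟩ := b
  obtain ⟨a, ha⟩ := a
  simp only at h
  induction h using Relation.ReflTransGen.head_induction_on with
  | refl => exact Relation.ReflTransGen.refl
  | @head a c hac hcb ih =>
    have hc : c ∈ X := Reaches.mem hX hcb hb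
    exact Relation.ReflTransGen.head (b := (⟨c, hc⟩ : X)) hac (ih hc)

theorem reaches_induce_compl_iff {V : Type*} {D : LooplessDigraph V} {X : Set V}
    (hX : IsInitial D X) {a b : ↥Xᶜ} : Reaches (induce D Xᶜ) a b ↔ Reaches D a b := by
  refine ⟨Reaches.of_induce, fun h => ?_⟩
  obtain ⟨b, hb⟩ := b
  obtain ⟨a, ha⟩ := a
  simp only at h
  induction h with
  | refl => exact Relation.ReflTransGen.refl
  | @tail c b hac hcb ih =>
    have hc : c ∈ Xᶜ := fun hc => ha (Reaches.mem hX hac hc)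
    exact Relation.ReflTransGen.tail (b := (⟨c, hc⟩ : ↥Xᶜ)) (ih hc) hcb

/-- The number of strong components of `D` that meet `X`. -/
def componentsMeeting {V : Type*} (D : LooplessDigraph V) (X : Set V) : ℕ :=
  ((Quotient.mk (strongSetoid D)) '' X).ncard

theorem card_quotient_comap {V : Type*} (r : Setoid V) (X : Set V) :
    Nat.card (Quotient (r.comap ((↑) : X → V))) = (Quotient.mk r '' X).ncard := by
  rw [Nat.card_congr (Setoid.comapQuotientEquiv _ r), Set.range_comp, Subtype.range_coe,
    Nat.card_coe_set_eq]

theorem numStrongComponents_induce {V : Type*} {D : LooplessDigraph V} {X : Set V}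
    (hX : IsInitial D X) : numStrongComponents (induce D X) = componentsMeeting D X := by
  have : strongSetoid (induce D X) = (strongSetoid D).comap ((↑) : X → V) := by
    ext a b
    exact and_congr (reaches_induce_iff hX) (reaches_induce_iff hX)
  rw [numStrongComponents, this, card_quotient_comap, componentsMeeting]

theorem numStrongComponents_induce_compl {V : Type*} {D : LooplessDigraph V} {X : Set V}
    (hX : IsInitial D X) : numStrongComponents (induce D Xᶜ) = componentsMeeting D Xᶜ := by
  have : strongSetoid (induce D Xᶜ) = (strongSetoid D).comap ((↑) : ↥Xᶜ → V) := by
    ext a b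
    exact and_congr (reaches_induce_compl_iff hX) (reaches_induce_compl_iff hX)
  rw [numStrongComponents, this, card_quotient_comap, componentsMeeting]

theorem numStrongComponents_eq_add {V : Type*} [Finite V] {D : LooplessDigraph V} {X : Set V}
    (hX : IsInitial D X) : numStrongComponents D =
      numStrongComponents (induce D X) + numStrongComponents (induce D Xᶜ) := by
  rw [numStrongComponents_induce hX, numStrongComponents_induce_compl hX, componentsMeeting,
    componentsMeeting, ← Set.ncard_union_eq, ← Set.image_union, Set.union_compl_self,
    Set.image_univ_of_surjective Quotient.mk_surjective, Set.ncard_univ, numStrongComponents]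
  rw [Set.disjoint_left]
  rintro _ ⟨a, ha, rfl⟩ ⟨b, hb, hab⟩
  exact hb (Reaches.mem hX (Quotient.exact hab).1 ha)

theorem card_digraph {V : Type*} [Finite V] :
    Fintype.card (LooplessDigraph V) = 2 ^ (Nat.card V * (Nat.card V - 1)) := by
  classical
  have := Fintype.ofFinite V
  let e : LooplessDigraph V ≃ Set {p : V × V // p ∈ (Finset.univ : Finset V).offDiag} :=
    { toFun D := {p | D.1.Adj p.1.1 p.1.2}
      invFun S := ⟨⟨fun a b => ∃ h : (a, b) ∈ (Finset.univ : Finset V).offDiag, ⟨(a, b), h⟩ ∈ S⟩,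
        fun v ⟨h, _⟩ => (Finset.mem_offDiag.1 h).2.2 rfl⟩
      left_inv D := by
        refine Subtype.ext (Digraph.ext ?_)
        ext a b
        have : D.1.Adj a b → a ≠ b := fun h hab => D.2 b (hab ▸ h)
        simpa using this
      right_inv S := by
        ext ⟨⟨a, b⟩, h⟩
        simp only [Set.mem_ofPred_eq]
        exact ⟨fun ⟨_, h⟩ => h, fun hS => ⟨h, hS⟩⟩ }
  rw [Fintype.card_congr e, Fintype.card_set, Fintype.card_coe, Finset.offDiag_card,
    Finset.card_univ, Nat.card_eq_fintype_card, Nat.mul_sub_one]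

/-- Reachability is symmetric: the digraph is a disjoint union of strongly connected digraphs. -/
def IsStrongUnion {V : Type*} (D : LooplessDigraph V) : Prop :=
  ∀ a b, Reaches D a b → Reaches D b a

/-- `X` is a union of source components of `D`: with a vertex `b` it contains every vertex from which
`b` can be reached, and such a vertex can be reached from `b`. -/
def IsSourceUnion {V : Type*} (D : LooplessDigraph V) (X : Set V) : Prop :=
  ∀ a b, Reaches D a b → b ∈ X → a ∈ X ∧ Reaches D b a

theorem isSourceUnion_iff {V : Type*} {D : LooplessDigraph V} {X : Set V} :
    IsSourceUnion D X ↔ IsInitial D X ∧ IsStrongUnion (induce D X) := by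
  constructor
  · intro h
    have hX : IsInitial D X := fun a b hab hb => (h a b (Relation.ReflTransGen.single hab) hb).1
    refine ⟨hX, fun a b hab => ?_⟩
    rw [reaches_induce_iff hX] at hab ⊢
    exact (h a b hab b.2).2
  · rintro ⟨hX, h⟩ a b hab hb
    have ha := Reaches.mem hX hab hb
    have := h ⟨a, ha⟩ ⟨b, hb⟩ ((reaches_induce_iff hX).2 hab)
    exact ⟨ha, (reaches_induce_iff hX).1 this⟩

/-- A vertex that is minimal for reachability lies in a source component. -/
theorem exists_source {V : Type*} [Finite V] [Nonempty V] (D : LooplessDigraph V) :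
    ∃ v, ∀ a, Reaches D a v → Reaches D v a := by
  let P : Preorder V :=
    { le := Reaches D
      le_refl := fun _ => Relation.ReflTransGen.refl
      le_trans := fun _ _ _ => Relation.ReflTransGen.trans }
  obtain ⟨v, -, hv⟩ := WellFoundedLT.exists_minimal inferInstance (Set.univ : Set V) Set.univ_nonempty
  exact ⟨v, fun a ha => hv (Set.mem_univ a) ha⟩

open Classical in
/-- The involution toggling a fixed source component shows that unions of source components cancel
when they are counted with sign. -/
theorem sum_isSourceUnion_eq_zero {V R : Type*} [Finite V] [Nonempty V] [CommRing R]
    [Fintype (Set V)] (D : LooplessDigraph V) :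
    ∑ X : Set V, (if IsSourceUnion D X then (-1 : R) ^ componentsMeeting D X else 0) = 0 := by
  obtain ⟨v, hv⟩ := exists_source D
  set C : Set V := {a | Reaches D a v} with hC
  have hsub : ∀ X, IsSourceUnion D X → v ∈ X → C ⊆ X := fun X hX hvX a ha => (hX a v ha hvX).1
  have hunion : ∀ X, IsSourceUnion D X → IsSourceUnion D (X ∪ C) := by
    rintro X hX a b hab (hb | hb)
    · exact ⟨Or.inl (hX a b hab hb).1, (hX a b hab hb).2⟩
    · have : Reaches D a v := Relation.ReflTransGen.trans hab hb
      exact ⟨Or.inr this, Relation.ReflTransGen.trans hb (hv a this)⟩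
  have hdiff : ∀ X, IsSourceUnion D X → IsSourceUnion D (X \ C) := by
    rintro X hX a b hab ⟨hb, hb'⟩
    obtain ⟨h1, h2⟩ := hX a b hab hb
    exact ⟨⟨h1, fun h => hb' (Relation.ReflTransGen.trans h2 h)⟩, h2⟩
  have hdisj : ∀ X, IsSourceUnion D X → v ∉ X → Disjoint X C := by
    intro X hX hvX
    rw [Set.disjoint_left]
    exact fun a ha haC => hvX (hX v a (hv a haC) ha).1
  have hvC : v ∈ C := Relation.ReflTransGen.refl
  have hcount : ∀ X, IsSourceUnion D X → v ∉ X →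
      componentsMeeting D (X ∪ C) = componentsMeeting D X + 1 := by
    intro X hX hvX
    have hCimg : Quotient.mk (strongSetoid D) '' C = {Quotient.mk (strongSetoid D) v} := by
      ext q
      constructor
      · rintro ⟨a, ha, rfl⟩
        exact Quotient.sound ⟨ha, hv a ha⟩
      · rintro rfl
        exact ⟨v, hvC, rfl⟩
    rw [componentsMeeting, Set.image_union, hCimg, Set.union_singleton,
      Set.ncard_insert_of_notMem, componentsMeeting]
    rintro ⟨a, ha, hav⟩
    exact hvX (hX v a (Quotient.exact hav).2 ha).1
  have key : ∀ X, IsSourceUnion D X → v ∉ X →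
      (-1 : R) ^ componentsMeeting D X + (-1 : R) ^ componentsMeeting D (X ∪ C) = 0 := by
    intro X hX hvX
    rw [hcount X hX hvX]
    ring
  rw [← Finset.sum_filter]
  refine Finset.sum_involution (fun X _ => if v ∈ X then X \ C else X ∪ C) ?_ ?_ ?_ ?_
  · intro X hX
    have hX : IsSourceUnion D X := (Finset.mem_filter.1 hX).2
    by_cases hvX : v ∈ X
    -- Both cases are `key`, for the one of `X` and its image that does not contain `v`.
    · have h := key (X \ C) (hdiff X hX) (fun h => h.2 hvC)
      rw [Set.sdiff_union_of_subset (hsub X hX hvX)] at h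
      rwa [if_pos hvX, add_comm]
    · rw [if_neg hvX]
      exact key X hX hvX
  · intro X hX _ h
    by_cases hvX : v ∈ X
    · rw [if_pos hvX] at h
      exact (h.symm ▸ hvX : v ∈ X \ C).2 hvC
    · rw [if_neg hvX] at h
      exact hvX (h ▸ Or.inr hvC)
  · intro X hX
    have hX : IsSourceUnion D X := (Finset.mem_filter.1 hX).2
    refine Finset.mem_filter.2 ⟨Finset.mem_univ _, ?_⟩
    split_ifs
    exacts [hdiff X hX, hunion X hX]
  · intro X hX
    have hX : IsSourceUnion D X := (Finset.mem_filter.1 hX).2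
    by_cases hvX : v ∈ X
    · rw [if_pos hvX, if_neg (fun h => h.2 hvC), Set.sdiff_union_of_subset (hsub X hX hvX)]
    · rw [if_neg hvX, if_pos (Set.mem_union_right X hvC), Set.union_sdiff_right, (hdisj X hX hvX).sdiff_eq_left]

/-! ### Counting digraphs by strong components -/

/-- Transport of a digraph along a bijection of the vertex sets. -/
def relabel {V W : Type*} (e : V ≃ W) : LooplessDigraph V ≃ LooplessDigraph W where
  toFun D := ⟨⟨fun a b => D.1.Adj (e.symm a) (e.symm b)⟩, fun v => D.2 (e.symm v)⟩
  invFun D := ⟨⟨fun a b => D.1.Adj (e a) (e b)⟩, fun v => D.2 (e v)⟩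
  left_inv D := Subtype.ext (Digraph.ext (by ext; simp))
  right_inv D := Subtype.ext (Digraph.ext (by ext; simp))

theorem reaches_relabel {V W : Type*} (e : V ≃ W) (D : LooplessDigraph V) (a b : V) :
    Reaches (relabel e D) (e a) (e b) ↔ Reaches D a b := by
  constructor
  · intro h
    have := Relation.ReflTransGen.lift (r := (relabel e D).1.Adj) (p := D.1.Adj) e.symm
      (fun _ _ h => h) _ _ h
    simpa [Function.onFun, Reaches] using this
  · exact Relation.ReflTransGen.lift (r := D.1.Adj) (p := (relabel e D).1.Adj) e
      (fun a b h => by simpa [relabel, Function.onFun] using h) _ _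

theorem numStrongComponents_relabel {V W : Type*} (e : V ≃ W) (D : LooplessDigraph V) :
    numStrongComponents (relabel e D) = numStrongComponents D :=
  (Nat.card_congr (Quotient.congr e fun a b =>
    (and_congr (reaches_relabel e D a b) (reaches_relabel e D b a)).symm)).symm

theorem isStrongUnion_relabel {V W : Type*} (e : V ≃ W) (D : LooplessDigraph V) :
    IsStrongUnion (relabel e D) ↔ IsStrongUnion D := by
  simp only [IsStrongUnion, ← e.forall_congr_right, reaches_relabel]

theorem isStronglyConnected_relabel {V W : Type*} (e : V ≃ W) (D : LooplessDigraph V) :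
    IsStronglyConnected (relabel e D) ↔ IsStronglyConnected D := by
  simp only [IsStronglyConnected, ← e.forall_congr_right, reaches_relabel, e.nonempty_congr]

/-- The sum of `u ^ (number of strong components)` over all digraphs on `V`. -/
def digraphSum (V : Type*) [Finite V] {R : Type*} [CommRing R] (u : R) : R :=
  ∑ D : LooplessDigraph V, u ^ numStrongComponents D

open Classical in
/-- The sum of `t ^ (number of strong components)` over all digraphs on `V` that are disjoint unions
of strongly connected digraphs. -/
def strongUnionSum (V : Type*) [Finite V] {R : Type*} [CommRing R] (t : R) : R :=
  ∑ D : LooplessDigraph V, if IsStrongUnion D then t ^ numStrongComponents D else 0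

theorem digraphSum_eq {V : Type*} [Finite V] {R : Type*} [CommRing R] (u : R) :
    digraphSum V u = digraphSum (Fin (Nat.card V)) u := by
  rw [digraphSum, digraphSum, ← (relabel (Finite.equivFin V)).sum_comp]
  simp_rw [numStrongComponents_relabel]

open Classical in
theorem strongUnionSum_eq {V : Type*} [Finite V] {R : Type*} [CommRing R] (t : R) :
    strongUnionSum V t = strongUnionSum (Fin (Nat.card V)) t := by
  rw [strongUnionSum, strongUnionSum, ← (relabel (Finite.equivFin V)).sum_comp]
  refine Finset.sum_congr rfl fun D _ => ?_
  rw [numStrongComponents_relabel]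
  exact if_congr (isStrongUnion_relabel _ D).symm rfl rfl

open Classical in
theorem sum_isStronglyConnected {V : Type*} [Finite V] {R : Type*} [CommRing R] (t : R) :
    (∑ D : LooplessDigraph V, if IsStronglyConnected D then t else 0) =
      strongCount (Nat.card V) * t := by
  rw [Finset.sum_ite, Finset.sum_const_zero, add_zero, Finset.sum_const, nsmul_eq_mul, strongCount,
    ← Nat.card_congr ((relabel (Finite.equivFin V)).subtypeEquiv fun D =>
      (isStronglyConnected_relabel (Finite.equivFin V) D).symm), Nat.card_eq_fintype_card,
    Fintype.card_subtype]

open Classical in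
/-- The pairs of a digraph and a union `X` of its source components cancel when counted with sign; for
fixed `X` they are given by a disjoint union of strongly connected digraphs on `X`, a digraph on the
complement, and arcs from `X` to the complement. -/
theorem sum_split_strongUnion {V R : Type*} [Finite V] [Nonempty V] [CommRing R] [Fintype (Set V)]
    (u : R) : ∑ X : Set V, 2 ^ (X.ncard * Xᶜ.ncard) *
      (strongUnionSum X (-u) * digraphSum ↥Xᶜ u) = 0 := by
  simp only [strongUnionSum, digraphSum, ← sum_isInitial]
  rw [Finset.sum_comm]
  refine Finset.sum_eq_zero fun D _ => ?_
  have h : ∀ X : Set V, (if IsInitial D X then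
      (if IsStrongUnion (induce D X) then (-u) ^ numStrongComponents (induce D X) else 0) *
        u ^ numStrongComponents (induce D Xᶜ) else 0) =
      u ^ numStrongComponents D *
        (if IsSourceUnion D X then (-1 : R) ^ componentsMeeting D X else 0) := by
    intro X
    rw [isSourceUnion_iff]
    by_cases hX : IsInitial D X
    · by_cases hs : IsStrongUnion (induce D X)
      · simp only [hX, hs, and_self, if_true]
        rw [numStrongComponents_eq_add hX, ← numStrongComponents_induce hX, neg_pow]
        ring
      · simp [hs]
    · simp [hX]
  simp_rw [h]
  rw [← Finset.mul_sum, sum_isSourceUnion_eq_zero, mul_zero]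

theorem numStrongComponents_eq_one {V : Type*} {D : LooplessDigraph V}
    (h : IsStronglyConnected D) : numStrongComponents D = 1 := by
  obtain ⟨⟨v⟩, h⟩ := h
  rw [numStrongComponents, Nat.card_eq_one_iff_exists]
  refine ⟨Quotient.mk _ v, fun q => ?_⟩
  induction q using Quotient.inductionOn with
  | h a => exact Quotient.sound ⟨h a v, h v a⟩

/-- A disjoint union of strongly connected digraphs in which `v` has the component `X` consists of a
strongly connected digraph on `X` and such a disjoint union on the complement. -/
theorem isStrongUnion_and_class_eq_iff {V : Type*} {D : LooplessDigraph V} {X : Set V} {v : V}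
    (hv : v ∈ X) : IsStrongUnion D ∧ {a | Reaches D a v} = X ↔
      (IsInitial D X ∧ IsInitial D Xᶜ) ∧ IsStronglyConnected (induce D X) ∧
        IsStrongUnion (induce D Xᶜ) := by
  constructor
  · rintro ⟨hD, rfl⟩
    have h1 : IsInitial D {a | Reaches D a v} := fun a b hab hb =>
      Relation.ReflTransGen.head hab hb
    have h2 : IsInitial D {a | Reaches D a v}ᶜ := fun a b hab hb ha =>
      hb (Relation.ReflTransGen.trans (hD a b (Relation.ReflTransGen.single hab)) ha)
    refine ⟨⟨h1, h2⟩, ⟨⟨⟨v, hv⟩⟩, fun a b => ?_⟩, fun a b hab => ?_⟩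
    · exact (reaches_induce_iff h1).2 (Relation.ReflTransGen.trans a.2 (hD _ _ b.2))
    · exact (reaches_induce_iff h2).2 (hD _ _ hab.of_induce)
  · rintro ⟨⟨h1, h2⟩, h3, h4⟩
    refine ⟨fun a b hab => ?_, ?_⟩
    · by_cases hb : b ∈ X
      · exact (h3.2 ⟨b, hb⟩ ⟨a, hab.mem h1 hb⟩).of_induce
      · exact (h4 ⟨a, hab.mem h2 hb⟩ ⟨b, hb⟩ ((reaches_induce_iff h2).2 hab)).of_induce
    · ext a
      exact ⟨fun h => Reaches.mem h1 h hv, fun h => (h3.2 ⟨a, h⟩ ⟨v, hv⟩).of_induce⟩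

open Classical in
/-- Marking a vertex `v` and grouping by its component `X`; each `X` occurs once for every `v ∈ X`. -/
theorem card_mul_strongUnionSum {V R : Type*} [Finite V] [CommRing R] [Fintype (Set V)] (t : R) :
    (Nat.card V : R) * strongUnionSum V t =
      t * ∑ X : Set V, (X.ncard : R) * strongCount X.ncard * strongUnionSum ↥Xᶜ t := by
  have := Fintype.ofFinite V
  have h : ∀ v : V, strongUnionSum V t =
      ∑ X : Set V, if v ∈ X then t * strongCount X.ncard * strongUnionSum ↥Xᶜ t else 0 := by
    intro v
    have h1 : ∀ D : LooplessDigraph V,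
        (if IsStrongUnion D then t ^ numStrongComponents D else 0) =
        ∑ X : Set V, if IsStrongUnion D ∧ {a | Reaches D a v} = X then
          t ^ numStrongComponents D else 0 := by
      intro D
      by_cases hD : IsStrongUnion D <;> simp [hD]
    rw [strongUnionSum]
    simp_rw [h1]
    rw [Finset.sum_comm]
    refine Finset.sum_congr rfl fun X _ => ?_
    by_cases hv : v ∈ X
    · rw [if_pos hv, strongUnionSum, mul_comm t, ← Nat.card_coe_set_eq X, ← sum_isStronglyConnected,
        ← sum_separated]
      refine Finset.sum_congr rfl fun D _ => ?_
      simp only [isStrongUnion_and_class_eq_iff hv]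
      by_cases hX : IsInitial D X ∧ IsInitial D Xᶜ
      · by_cases h3 : IsStronglyConnected (induce D X)
        · by_cases h4 : IsStrongUnion (induce D Xᶜ)
          · simp only [hX, h3, h4, and_self, if_true]
            rw [numStrongComponents_eq_add hX.1, numStrongComponents_eq_one h3, pow_add, pow_one]
          · simp [h4]
        · simp [h3]
      · simp only [hX, false_and, if_false]
    · rw [if_neg hv]
      refine Finset.sum_eq_zero fun D _ => if_neg ?_
      rintro ⟨-, rfl⟩
      exact hv Relation.ReflTransGen.refl
  calc (Nat.card V : R) * strongUnionSum V t = ∑ v : V, strongUnionSum V t := by simp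
    _ = ∑ v : V, ∑ X : Set V,
        if v ∈ X then t * strongCount X.ncard * strongUnionSum ↥Xᶜ t else 0 :=
      Finset.sum_congr rfl fun v _ => h v
    _ = _ := by
      rw [Finset.sum_comm, Finset.mul_sum]
      refine Finset.sum_congr rfl fun X _ => ?_
      rw [← Finset.sum_filter, Finset.sum_const, nsmul_eq_mul, Set.ncard_eq_toFinset_card' X,
        Set.filter_mem_univ_eq_toFinset]
      ring

theorem sum_set_ncard {n : ℕ} {R : Type*} [CommRing R] (f : ℕ → ℕ → R) :
    ∑ X : Set (Fin n), f X.ncard Xᶜ.ncard =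
      ∑ k ∈ Finset.range (n + 1), (n.choose k : R) * f k (n - k) := by
  classical
  have h : ∀ X : Set (Fin n), f X.ncard Xᶜ.ncard = f X.ncard (n - X.ncard) := by
    intro X
    rw [Set.ncard_compl, Nat.card_fin]
  simp_rw [h]
  rw [← (Fintype.finsetEquivSet (α := Fin n)).sum_comp]
  have := Finset.sum_powerset_apply_card (fun k => f k (n - k)) (x := (Finset.univ : Finset (Fin n)))
  simpa using this

theorem numStrongComponents_of_isEmpty {V : Type*} [IsEmpty V] (D : LooplessDigraph V) :
    numStrongComponents D = 0 := by
  have : IsEmpty (Quotient (strongSetoid D)) := Quotient.instIsEmpty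
  rw [numStrongComponents, Nat.card_of_isEmpty]

theorem digraphSum_fin_zero {R : Type*} [CommRing R] (u : R) : digraphSum (Fin 0) u = 1 := by
  simp [digraphSum, numStrongComponents_of_isEmpty, card_digraph]

theorem strongUnionSum_fin_zero {R : Type*} [CommRing R] (t : R) :
    strongUnionSum (Fin 0) t = 1 := by
  have (D : LooplessDigraph (Fin 0)) : IsStrongUnion D := fun a => a.elim0
  simp [strongUnionSum, numStrongComponents_of_isEmpty, card_digraph, this]

/-- Counting pairs of a digraph and a union of its source components with sign, by the size of that
union. -/
theorem sum_choose_strongUnionSum_mul_digraphSum {R : Type*} [CommRing R] (u : R) (n : ℕ) :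
    ∑ k ∈ Finset.range (n + 1), (n.choose k : R) * (2 ^ (k * (n - k)) *
      (strongUnionSum (Fin k) (-u) * digraphSum (Fin (n - k)) u)) = if n = 0 then 1 else 0 := by
  split_ifs with hn
  · subst hn
    simp [digraphSum_fin_zero, strongUnionSum_fin_zero]
  · have : Nonempty (Fin n) := ⟨⟨0, Nat.pos_of_ne_zero hn⟩⟩
    rw [← sum_set_ncard (fun k l => 2 ^ (k * l) *
      (strongUnionSum (Fin k) (-u) * digraphSum (Fin l) u)), ← sum_split_strongUnion (V := Fin n) u]
    refine Finset.sum_congr rfl fun X _ => ?_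
    rw [strongUnionSum_eq (V := X), digraphSum_eq (V := ↥Xᶜ), Nat.card_coe_set_eq,
      Nat.card_coe_set_eq]

/-- Marking a vertex of a disjoint union of strongly connected digraphs, and splitting off the
component of that vertex. -/
theorem natCast_mul_strongUnionSum {R : Type*} [CommRing R] (t : R) (n : ℕ) :
    (n : R) * strongUnionSum (Fin n) t = t * ∑ k ∈ Finset.range (n + 1),
      (n.choose k : R) * (k * strongCount k * strongUnionSum (Fin (n - k)) t) := by
  rw [← sum_set_ncard (fun k l => (k : R) * strongCount k * strongUnionSum (Fin l) t)]
  have h := card_mul_strongUnionSum (V := Fin n) t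
  rw [Nat.card_fin] at h
  rw [h]
  congr 1
  refine Finset.sum_congr rfl fun X _ => ?_
  rw [strongUnionSum_eq (V := ↥Xᶜ), Nat.card_coe_set_eq]

/-! ### Generating functions and the decomposition by components -/

theorem choose_two_add (k l : ℕ) :
    (k + l).choose 2 = k.choose 2 + l.choose 2 + k * l := by
  induction l with
  | zero => simp
  | succ l ih =>
    rw [← add_assoc, Nat.choose_succ_succ' _ 1, ih, Nat.choose_succ_succ' l 1, Nat.choose_one_right,
      Nat.choose_one_right]
    ring

theorem mul_pred_eq_two_mul_choose (n : ℕ) : n * (n - 1) = 2 * n.choose 2 := by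
  rw [Nat.choose_two_right, Nat.mul_div_cancel' (Nat.even_mul_pred_self n).two_dvd]

/-- The exponential generating function of a real sequence. -/
def realExpGF (a : ℕ → ℝ) : ℝ⟦X⟧ := PowerSeries.mk fun n => a n / (n.factorial : ℝ)

theorem coeff_realExpGF (a : ℕ → ℝ) (n : ℕ) :
    PowerSeries.coeff n (realExpGF a) = a n / (n.factorial : ℝ) := PowerSeries.coeff_mk _ _

theorem factorial_mul_coeff_realExpGF (a : ℕ → ℝ) (n : ℕ) :
    (n.factorial : ℝ) * PowerSeries.coeff n (realExpGF a) = a n := by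
  rw [coeff_realExpGF, mul_div_cancel₀ _ (by positivity)]

theorem realExpGF_factorial_mul_coeff (A : ℝ⟦X⟧) :
    realExpGF (fun n => (n.factorial : ℝ) * PowerSeries.coeff n A) = A := by
  ext n
  rw [coeff_realExpGF, mul_div_cancel_left₀ _ (by positivity)]

/-- The binomial convolution, which describes products of exponential generating functions. -/
def binomConv (a b : ℕ → ℝ) (n : ℕ) : ℝ :=
  ∑ k ∈ Finset.range (n + 1), (n.choose k : ℝ) * (a k * b (n - k))

theorem realExpGF_mul (a b : ℕ → ℝ) :
    realExpGF a * realExpGF b = realExpGF (binomConv a b) := by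
  ext n
  rw [PowerSeries.coeff_mul, Finset.Nat.sum_antidiagonal_eq_sum_range_succ
    (fun i j => PowerSeries.coeff i (realExpGF a) * PowerSeries.coeff j (realExpGF b)),
    coeff_realExpGF, binomConv, Finset.sum_div]
  refine Finset.sum_congr rfl fun k hk => ?_
  have hk : k ≤ n := Nat.lt_succ_iff.1 (Finset.mem_range.1 hk)
  rw [coeff_realExpGF, coeff_realExpGF, Nat.cast_choose ℝ hk]
  field_simp

/-- The Hadamard product with `graphicSet 1`: it turns exponential generating functions into graphic
ones. -/
def toGraphic (A : ℝ⟦X⟧) : ℝ⟦X⟧ :=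
  PowerSeries.mk fun n => PowerSeries.coeff n A / (2 : ℝ) ^ (n.choose 2)

theorem coeff_toGraphic (A : ℝ⟦X⟧) (n : ℕ) : PowerSeries.coeff n (toGraphic A) =
    PowerSeries.coeff n A / (2 : ℝ) ^ (n.choose 2) := PowerSeries.coeff_mk _ _

theorem toGraphic_realExpGF (a : ℕ → ℝ) :
    toGraphic (realExpGF a) = realExpGF fun n => a n / (2 : ℝ) ^ (n.choose 2) := by
  ext n
  rw [coeff_toGraphic, coeff_realExpGF, coeff_realExpGF, div_right_comm]

theorem toGraphic_one : toGraphic 1 = 1 := by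
  ext n
  rw [coeff_toGraphic, PowerSeries.coeff_one]
  split_ifs with h
  · simp [h]
  · simp

theorem toGraphic_neg (A : ℝ⟦X⟧) : toGraphic (-A) = -toGraphic A := by
  ext n
  simp [coeff_toGraphic, neg_div]

theorem toGraphic_smul (c : ℝ) (A : ℝ⟦X⟧) : toGraphic (c • A) = c • toGraphic A := by
  ext n
  simp [coeff_toGraphic, mul_div_assoc]

theorem SCD_eq_realExpGF : SCD = realExpGF fun n => (strongCount n : ℝ) := rfl

theorem SCDHat_eq_toGraphic : SCDHat = toGraphic SCD := by
  rw [SCD_eq_realExpGF, toGraphic_realExpGF]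
  rfl

theorem SHat_eq_toGraphic (k : ℕ) :
    SHat k = toGraphic (realExpGF fun n => (componentCount k n : ℝ)) := by
  rw [toGraphic_realExpGF]
  rfl

/-- A binomial convolution with arcs going from the first part to the second part is a product of
graphic generating functions. -/
theorem toGraphic_mul_toGraphic (a b : ℕ → ℝ) :
    toGraphic (realExpGF a) * toGraphic (realExpGF b) = toGraphic (realExpGF fun n =>
      ∑ k ∈ Finset.range (n + 1), (n.choose k : ℝ) * (2 ^ (k * (n - k)) * (a k * b (n - k)))) := by
  rw [toGraphic_realExpGF, toGraphic_realExpGF, toGraphic_realExpGF, realExpGF_mul]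
  congr 1
  ext n
  rw [binomConv, Finset.sum_div]
  refine Finset.sum_congr rfl fun k hk => ?_
  obtain ⟨l, rfl⟩ := Nat.exists_eq_add_of_le (Nat.lt_succ_iff.1 (Finset.mem_range.1 hk))
  rw [Nat.add_sub_cancel_left, choose_two_add, pow_add, pow_add]
  field_simp

theorem realExpGF_ite : realExpGF (fun n => if n = 0 then 1 else 0) = 1 := by
  ext n
  rw [coeff_realExpGF, PowerSeries.coeff_one]
  split_ifs with h
  · simp [h]
  · simp

/-- The operator `z d/dz`. -/
def theta (A : ℝ⟦X⟧) : ℝ⟦X⟧ := PowerSeries.X * PowerSeries.derivative ℝ A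

theorem coeff_theta (A : ℝ⟦X⟧) (n : ℕ) :
    PowerSeries.coeff n (theta A) = n * PowerSeries.coeff n A := by
  cases n with
  | zero => simp [theta]
  | succ n =>
    rw [theta, PowerSeries.coeff_succ_X_mul, PowerSeries.coeff_derivative]
    push_cast
    ring

theorem theta_mul (A B : ℝ⟦X⟧) : theta (A * B) = theta A * B + A * theta B := by
  simp only [theta, Derivation.leibniz, smul_eq_mul]
  ring

theorem theta_smul (c : ℝ) (A : ℝ⟦X⟧) : theta (c • A) = c • theta A := by
  ext n
  simp only [coeff_theta, PowerSeries.coeff_smul, smul_eq_mul]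
  ring

theorem theta_neg (A : ℝ⟦X⟧) : theta (-A) = -theta A := by
  simp only [theta, map_neg, mul_neg]

theorem eq_of_theta_eq {A B : ℝ⟦X⟧} (h : theta A = theta B)
    (h0 : PowerSeries.coeff 0 A = PowerSeries.coeff 0 B) : A = B := by
  ext n
  rcases Nat.eq_zero_or_pos n with rfl | hn
  · exact h0
  · have := congrArg (PowerSeries.coeff n) h
    rw [coeff_theta, coeff_theta] at this
    exact mul_left_cancel₀ (by positivity) this

theorem theta_realExpGF (a : ℕ → ℝ) : theta (realExpGF a) = realExpGF fun n => n * a n := by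
  ext n
  rw [coeff_theta, coeff_realExpGF, coeff_realExpGF, mul_div_assoc]

theorem strongCount_zero : strongCount 0 = 0 := by
  have : IsEmpty {D : LooplessDigraph (Fin 0) // IsStronglyConnected D} :=
    ⟨fun D => D.2.1.elim Fin.elim0⟩
  rw [strongCount, Nat.card_of_isEmpty]

theorem coeff_zero_SCD : PowerSeries.coeff 0 SCD = 0 := by
  simp [SCD_eq_realExpGF, coeff_realExpGF, strongCount_zero]

/-! ### The decomposition by number of components -/

theorem coeff_digraphSum (k n : ℕ) :
    (digraphSum (Fin n) (Polynomial.X : ℝ[X])).coeff k = componentCount k n := by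
  classical
  rw [digraphSum, Polynomial.finsetSum_coeff, componentCount, Nat.card_eq_fintype_card,
    Fintype.card_subtype]
  simp [Polynomial.coeff_X_pow, eq_comm]

/-- `(-1) ^ i` times the exponential generating function of disjoint unions of `i` strongly
connected digraphs. -/
def signedUnionGF (i : ℕ) : ℝ⟦X⟧ :=
  realExpGF fun n => (strongUnionSum (Fin n) (-Polynomial.X : ℝ[X])).coeff i

theorem coeff_zero_signedUnionGF (i : ℕ) :
    PowerSeries.coeff 0 (signedUnionGF i) = if i = 0 then 1 else 0 := by
  simp [signedUnionGF, coeff_realExpGF, strongUnionSum_fin_zero, Polynomial.coeff_one]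

/-- The coefficient of `u ^ (i + 1)` in the equation `θE = -u θ(SCD) E`. -/
theorem theta_signedUnionGF_succ (i : ℕ) :
    theta (signedUnionGF (i + 1)) = -(theta SCD * signedUnionGF i) := by
  rw [signedUnionGF, theta_realExpGF, SCD_eq_realExpGF, theta_realExpGF, signedUnionGF,
    realExpGF_mul]
  ext n
  rw [map_neg, coeff_realExpGF, coeff_realExpGF, ← neg_div]
  congr 1
  have h := congrArg (fun p => Polynomial.coeff p (i + 1))
    (natCast_mul_strongUnionSum (-Polynomial.X : ℝ[X]) n)
  simp only [neg_mul, Polynomial.coeff_neg, Polynomial.coeff_X_mul, Polynomial.finsetSum_coeff] at h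
  rw [← Polynomial.C_eq_natCast, Polynomial.coeff_C_mul] at h
  rw [h, binomConv]
  congr 1
  refine Finset.sum_congr rfl fun k _ => ?_
  rw [← Polynomial.C_eq_natCast, ← Polynomial.C_eq_natCast, ← Polynomial.C_eq_natCast,
    Polynomial.coeff_C_mul, ← Polynomial.C_mul, Polynomial.coeff_C_mul]

theorem theta_signedUnionGF_zero : theta (signedUnionGF 0) = 0 := by
  rw [signedUnionGF, theta_realExpGF]
  ext n
  rw [coeff_realExpGF]
  have h := congrArg (fun p => Polynomial.coeff p 0)
    (natCast_mul_strongUnionSum (-Polynomial.X : ℝ[X]) n)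
  simp only [neg_mul, Polynomial.coeff_neg, Polynomial.coeff_X_mul_zero] at h
  rw [← Polynomial.C_eq_natCast, Polynomial.coeff_C_mul] at h
  rw [h]
  simp

theorem signedUnionGF_zero : signedUnionGF 0 = 1 := by
  refine eq_of_theta_eq ?_ (by simp [coeff_zero_signedUnionGF])
  rw [theta_signedUnionGF_zero]
  simp [theta]

theorem signedUnionGF_one : signedUnionGF 1 = -SCD := by
  refine eq_of_theta_eq ?_ (by simp only [coeff_zero_signedUnionGF, map_neg, coeff_zero_SCD, one_ne_zero,
    if_false, neg_zero])
  rw [theta_signedUnionGF_succ 0, signedUnionGF_zero, mul_one, theta_neg]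

theorem signedUnionGF_two : signedUnionGF 2 = (1 / 2 : ℝ) • SCD ^ 2 := by
  refine eq_of_theta_eq ?_ ?_
  · rw [theta_signedUnionGF_succ 1, signedUnionGF_one]
    rw [theta_smul, pow_two, theta_mul, mul_comm SCD, ← two_smul ℝ, smul_smul]
    norm_num
  · rw [coeff_zero_signedUnionGF, PowerSeries.coeff_smul, pow_two, PowerSeries.coeff_mul]
    simp [coeff_zero_SCD]

theorem signedUnionGF_three : signedUnionGF 3 = -((1 / 6 : ℝ) • SCD ^ 3) := by
  refine eq_of_theta_eq ?_ ?_
  · rw [theta_signedUnionGF_succ 2, signedUnionGF_two]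
    rw [theta_neg, theta_smul, pow_succ' SCD 2, pow_two, theta_mul, theta_mul]
    have h3 : theta SCD * (SCD * SCD) + SCD * (theta SCD * SCD + SCD * theta SCD) =
        (3 : ℝ) • (theta SCD * (SCD * SCD)) := by
      rw [PowerSeries.smul_eq_C_mul, show PowerSeries.C (3 : ℝ) = 3 from map_ofNat _ 3]
      ring
    rw [h3, smul_smul, mul_smul_comm]
    norm_num
  · rw [coeff_zero_signedUnionGF, map_neg, PowerSeries.coeff_smul, pow_succ, PowerSeries.coeff_mul]
    simp [coeff_zero_SCD]

/-- The graphic generating function of digraphs by number of components is the inverse of that of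
signed disjoint unions of strongly connected digraphs. -/
theorem sum_signedUnionGF_mul_SHat (m : ℕ) :
    ∑ p ∈ Finset.HasAntidiagonal.antidiagonal m, toGraphic (signedUnionGF p.1) * SHat p.2 =
      if m = 0 then 1 else 0 := by
  simp only [SHat_eq_toGraphic, signedUnionGF, toGraphic_mul_toGraphic]
  ext n
  rw [map_sum]
  have h := congrArg (fun p => Polynomial.coeff p m)
    (sum_choose_strongUnionSum_mul_digraphSum (Polynomial.X : ℝ[X]) n)
  simp only [Polynomial.finsetSum_coeff] at h
  simp only [coeff_toGraphic, coeff_realExpGF, ← Finset.sum_div]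
  rw [Finset.sum_comm]
  have h2 : ∀ k ∈ Finset.range (n + 1), ∑ p ∈ Finset.HasAntidiagonal.antidiagonal m, (n.choose k : ℝ) *
      (2 ^ (k * (n - k)) * ((strongUnionSum (Fin k) (-Polynomial.X : ℝ[X])).coeff p.1 *
        (componentCount p.2 (n - k) : ℝ))) = ((n.choose k : ℝ[X]) * (2 ^ (k * (n - k)) *
      (strongUnionSum (Fin k) (-Polynomial.X) * digraphSum (Fin (n - k)) Polynomial.X))).coeff
        m := by
    intro k _
    rw [← Polynomial.C_eq_natCast, show (2 : ℝ[X]) = Polynomial.C 2 from rfl, ← Polynomial.C_pow,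
      Polynomial.coeff_C_mul, Polynomial.coeff_C_mul, Polynomial.coeff_mul, Finset.mul_sum,
      Finset.mul_sum]
    simp only [coeff_digraphSum]
  rw [Finset.sum_congr rfl h2, h]
  by_cases hn : n = 0 <;> by_cases hm : m = 0 <;>
    simp [hn, hm, Polynomial.coeff_one, PowerSeries.coeff_one]

theorem SHat_zero : SHat 0 = 1 := by
  simpa [signedUnionGF_zero, toGraphic_one] using sum_signedUnionGF_mul_SHat 0

theorem SHat_one : SHat 1 = SCDHat := by
  have h := sum_signedUnionGF_mul_SHat 1
  simp [Finset.Nat.antidiagonal_succ, signedUnionGF_zero, signedUnionGF_one, toGraphic_one,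
    toGraphic_neg, SHat_zero, ← SCDHat_eq_toGraphic] at h
  linear_combination h

theorem SHat_two : SHat 2 = SCDHat ^ 2 - (1 / 2 : ℝ) • toGraphic (SCD ^ 2) := by
  have h := sum_signedUnionGF_mul_SHat 2
  simp only [Finset.Nat.antidiagonal_succ, Finset.Nat.antidiagonal_zero, Finset.map_singleton,
    Finset.sum_cons, Finset.sum_singleton, Finset.map_cons] at h
  simp [signedUnionGF_zero, signedUnionGF_one, signedUnionGF_two, toGraphic_one, toGraphic_smul,
    toGraphic_neg, SHat_zero, SHat_one, ← SCDHat_eq_toGraphic, -one_div] at h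
  linear_combination h

theorem SHat_three : SHat 3 = SCDHat ^ 3 - SCDHat * toGraphic (SCD ^ 2) +
    (1 / 6 : ℝ) • toGraphic (SCD ^ 3) := by
  have h := sum_signedUnionGF_mul_SHat 3
  simp only [Finset.Nat.antidiagonal_succ, Finset.Nat.antidiagonal_zero, Finset.map_singleton,
    Finset.sum_cons, Finset.sum_singleton, Finset.map_cons] at h
  simp [signedUnionGF_zero, signedUnionGF_one, signedUnionGF_two, signedUnionGF_three,
    toGraphic_one, toGraphic_smul, toGraphic_neg, SHat_zero, SHat_one, SHat_two,
    ← SCDHat_eq_toGraphic, -one_div] at h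
  have h2 : (1 / 2 : ℝ) • toGraphic (SCD ^ 2) + (1 / 2 : ℝ) • toGraphic (SCD ^ 2) =
      toGraphic (SCD ^ 2) := by
    rw [← add_smul]; norm_num
  rw [mul_comm (toGraphic _) SCDHat, ← mul_smul_comm] at h
  linear_combination h - SCDHat * h2

/-! ### The decomposition of all digraphs -/

/-- The exponential generating function of disjoint unions of strongly connected digraphs, each
counted with sign `(-1) ^ (number of components)`; it is `exp (-SCD)`. -/
def signedUnionTotal : ℝ⟦X⟧ := realExpGF fun n => strongUnionSum (Fin n) (-1)

theorem digraphCount_eq (n : ℕ) : digraphCount n = 2 ^ (2 * n.choose 2) := by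
  rw [digraphCount, Nat.card_eq_fintype_card, card_digraph, Nat.card_fin, mul_pred_eq_two_mul_choose]

/-- There are `2 ^ (2 C(n,2))` digraphs on `n` vertices, so that their graphic generating function is
the exponential generating function of graphs. -/
theorem toGraphic_signedUnionTotal_mul :
    realExpGF (fun n => (2 : ℝ) ^ n.choose 2) * toGraphic signedUnionTotal = 1 := by
  have h1 : realExpGF (fun n => (2 : ℝ) ^ n.choose 2) =
      toGraphic (realExpGF fun n => digraphSum (Fin n) (1 : ℝ)) := by
    rw [toGraphic_realExpGF]
    congr 1
    ext n
    rw [eq_div_iff (by positivity), ← pow_add, ← two_mul, digraphSum]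
    simp [card_digraph, mul_pred_eq_two_mul_choose]
  rw [h1, mul_comm, signedUnionTotal, toGraphic_mul_toGraphic]
  simp only [sum_choose_strongUnionSum_mul_digraphSum, realExpGF_ite, toGraphic_one]

theorem theta_signedUnionTotal : theta signedUnionTotal = -(theta SCD * signedUnionTotal) := by
  rw [signedUnionTotal, theta_realExpGF, SCD_eq_realExpGF, theta_realExpGF, realExpGF_mul]
  ext n
  rw [map_neg, coeff_realExpGF, coeff_realExpGF, natCast_mul_strongUnionSum, neg_one_mul, neg_div]
  rfl

theorem coeff_zero_signedUnionTotal : PowerSeries.coeff 0 signedUnionTotal = 1 := by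
  simp [signedUnionTotal, coeff_realExpGF, strongUnionSum_fin_zero]

theorem abs_strongUnionSum_le (n : ℕ) :
    |strongUnionSum (Fin n) (-1 : ℝ)| ≤ 2 ^ (2 * n.choose 2) := by
  classical
  refine (Finset.abs_sum_le_sum_abs _ _).trans ?_
  calc _ ≤ ∑ D : LooplessDigraph (Fin n), (1 : ℝ) := by
        refine Finset.sum_le_sum fun D _ => ?_
        split_ifs <;> simp
    _ = _ := by simp [card_digraph, mul_pred_eq_two_mul_choose]

theorem strongCount_le (n : ℕ) : strongCount n ≤ 2 ^ (2 * n.choose 2) := by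
  rw [← digraphCount_eq]
  exact Nat.card_le_card_of_injective _ Subtype.val_injective

/-! ### Sequences with an expansion in negative powers of `α ^ n` -/

/-- `f n` is `O(α ^ (-R n))` up to a factor of polynomial growth. -/
def IsSmall (α : ℝ) (R : ℕ) (f : ℕ → ℝ) : Prop :=
  ∃ C : ℕ, f =O[atTop] fun n : ℕ => ((n : ℝ) + 1) ^ C / α ^ (R * n)

theorem isBigO_succ_pow {α : ℝ} (R : ℕ) {C D : ℕ} (h : C ≤ D) :
    (fun n : ℕ => ((n : ℝ) + 1) ^ C / α ^ (R * n)) =O[atTop]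
      fun n : ℕ => ((n : ℝ) + 1) ^ D / α ^ (R * n) := by
  simp only [div_eq_mul_inv]
  refine IsBigO.mul (IsBigO.of_bound 1 (Eventually.of_forall fun n => ?_)) (isBigO_refl _ _)
  rw [one_mul, norm_pow, norm_pow]
  refine pow_le_pow_right₀ ?_ h
  rw [Real.norm_of_nonneg (by positivity)]
  simp

theorem IsSmall.add {α : ℝ} {R : ℕ} {f g : ℕ → ℝ} (hf : IsSmall α R f) (hg : IsSmall α R g) :
    IsSmall α R (fun n => f n + g n) := by
  obtain ⟨C, hC⟩ := hf
  obtain ⟨D, hD⟩ := hg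
  exact ⟨max C D, (hC.trans (isBigO_succ_pow R (le_max_left _ _))).add
    (hD.trans (isBigO_succ_pow R (le_max_right _ _)))⟩

theorem IsSmall.const_mul {α : ℝ} {R : ℕ} {f : ℕ → ℝ} (c : ℝ) (hf : IsSmall α R f) :
    IsSmall α R (fun n => c * f n) := by
  obtain ⟨C, hC⟩ := hf
  exact ⟨C, hC.const_mul_left c⟩

theorem IsSmall.neg {α : ℝ} {R : ℕ} {f : ℕ → ℝ} (hf : IsSmall α R f) :
    IsSmall α R (fun n => -f n) := by
  obtain ⟨C, hC⟩ := hf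
  exact ⟨C, hC.neg_left⟩

theorem IsSmall.sub {α : ℝ} {R : ℕ} {f g : ℕ → ℝ} (hf : IsSmall α R f) (hg : IsSmall α R g) :
    IsSmall α R (fun n => f n - g n) := by
  simpa only [sub_eq_add_neg] using hf.add hg.neg

theorem isSmall_zero (α : ℝ) (R : ℕ) : IsSmall α R (fun _ => 0) := ⟨0, isBigO_zero _ _⟩

theorem IsSmall.congr {α : ℝ} {R : ℕ} {f g : ℕ → ℝ} (hf : IsSmall α R f)
    (h : ∀ᶠ n in atTop, f n = g n) : IsSmall α R g := by
  obtain ⟨C, hC⟩ := hf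
  exact ⟨C, hC.congr' h EventuallyEq.rfl⟩

theorem IsSmall.mono {α : ℝ} (hα : 1 < α) {R S : ℕ} (h : S ≤ R) {f : ℕ → ℝ}
    (hf : IsSmall α R f) : IsSmall α S f := by
  obtain ⟨C, hC⟩ := hf
  refine ⟨C, hC.trans (IsBigO.of_bound 1 (Eventually.of_forall fun n => ?_))⟩
  have : 0 < α := by linarith
  rw [one_mul, Real.norm_of_nonneg (by positivity), Real.norm_of_nonneg (by positivity)]
  gcongr
  exact hα.le

theorem IsSmall.bounded_mul {α : ℝ} {R : ℕ} {f g : ℕ → ℝ} (hf : IsSmall α R f) (C : ℕ)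
    (hg : ∀ n, |g n| ≤ ((n : ℝ) + 1) ^ C) : IsSmall α R (fun n => g n * f n) := by
  obtain ⟨D, hD⟩ := hf
  refine ⟨C + D, ?_⟩
  have h : g =O[atTop] fun n : ℕ => ((n : ℝ) + 1) ^ C :=
    IsBigO.of_bound 1 (Eventually.of_forall fun n => by
      rw [one_mul, Real.norm_eq_abs, Real.norm_of_nonneg (by positivity)]
      exact hg n)
  refine (h.mul hD).congr_right fun n => ?_
  rw [pow_add, mul_div_assoc]

/-- Shifting a sequence and dividing it by `α ^ (q (n - k))` raises its order by `q`. -/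
theorem IsSmall.shift {α : ℝ} (hα : 1 < α) {R : ℕ} {f : ℕ → ℝ} (hf : IsSmall α R f) (k q : ℕ) :
    IsSmall α (R + q) (fun n => f (n - k) / α ^ (q * (n - k))) := by
  obtain ⟨C, hC⟩ := hf
  have hα0 : 0 < α := by linarith
  refine ⟨C, ?_⟩
  have h1 := (hC.comp_tendsto (tendsto_sub_atTop_nat k)).mul
    (isBigO_refl (fun n : ℕ => (α ^ (q * (n - k)))⁻¹) atTop)
  simp only [Function.comp_def, ← div_eq_mul_inv] at h1
  refine h1.trans (IsBigO.of_bound (α ^ ((R + q) * k)) ?_)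
  filter_upwards [eventually_ge_atTop k] with n hn
  obtain ⟨j, rfl⟩ := Nat.exists_eq_add_of_le hn
  rw [Nat.add_sub_cancel_left, Real.norm_of_nonneg (by positivity),
    Real.norm_of_nonneg (by positivity), div_div, show α ^ ((R + q) * (k + j)) =
      α ^ ((R + q) * k) * (α ^ (R * j) * α ^ (q * j)) by ring, mul_div_assoc',
    mul_div_mul_left _ _ (by positivity)]
  gcongr
  exact_mod_cast Nat.le_add_left j k

theorem IsSmall.exists_bound {α : ℝ} {f : ℕ → ℝ} (hf : IsSmall α 0 f) :
    ∃ (A : ℝ) (C : ℕ), 0 ≤ A ∧ ∀ n, |f n| ≤ A * ((n : ℝ) + 1) ^ C := by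
  obtain ⟨C, hC⟩ := hf
  obtain ⟨A, hA, h⟩ := bound_of_isBigO_nat_atTop hC
  refine ⟨A, C, hA.le, fun n => ?_⟩
  have := @h n (by rw [zero_mul, pow_zero, div_one]; positivity)
  simpa [abs_of_nonneg (by positivity : (0 : ℝ) ≤ (n : ℝ) + 1)] using this

/-! ### Evaluation in the basis of falling factorials -/

theorem fallingEval_add (P Q : ℝ[X]) (n : ℕ) :
    fallingEval (P + Q) n = fallingEval P n + fallingEval Q n :=
  Polynomial.sum_add_index _ _ _ (fun _ => by simp) (fun _ _ _ => by ring)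

theorem fallingEval_monomial (l : ℕ) (c : ℝ) (n : ℕ) :
    fallingEval (Polynomial.monomial l c) n = c * n.descFactorial l :=
  Polynomial.sum_monomial_index _ _ (by simp)

theorem fallingEval_C_mul (c : ℝ) (P : ℝ[X]) (n : ℕ) :
    fallingEval (Polynomial.C c * P) n = c * fallingEval P n := by
  induction P using Polynomial.induction_on' with
  | add P Q hP hQ => rw [mul_add, fallingEval_add, fallingEval_add, hP, hQ, mul_add]
  | monomial l a =>
    rw [Polynomial.C_mul_monomial, fallingEval_monomial, fallingEval_monomial, mul_assoc]

/-- Since `n(n-1)⋯(n-k+1) · (n-k)⋯(n-k-l+1) = n(n-1)⋯(n-k-l+1)`, a binomial coefficient acts on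
falling factorials as multiplication by `w ^ k / k!`. -/
theorem choose_mul_fallingEval (P : ℝ[X]) (n k : ℕ) :
    (n.choose k : ℝ) * fallingEval P (n - k) =
      (k.factorial : ℝ)⁻¹ * fallingEval (Polynomial.X ^ k * P) n := by
  induction P using Polynomial.induction_on' with
  | add P Q hP hQ => rw [mul_add, fallingEval_add, fallingEval_add, mul_add, hP, hQ, mul_add]
  | monomial l a =>
    rw [Polynomial.X_pow_mul_monomial, fallingEval_monomial, fallingEval_monomial,
      ← Nat.descFactorial_mul_descFactorial (Nat.le_add_left k l), Nat.add_sub_cancel,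
      Nat.descFactorial_eq_factorial_mul_choose n k]
    push_cast
    field_simp

theorem fallingEval_X_mul_add (P : ℝ[X]) (n : ℕ) :
    fallingEval (Polynomial.X * P + Polynomial.X * Polynomial.derivative P) n =
      n * fallingEval P n := by
  induction P using Polynomial.induction_on' with
  | add P Q hP hQ =>
    rw [fallingEval_add] at hP hQ ⊢
    rw [Polynomial.derivative_add, mul_add, mul_add, fallingEval_add, fallingEval_add,
      fallingEval_add, mul_add, ← hP, ← hQ]
    ring
  | monomial l a =>
    have h2 : Polynomial.X * Polynomial.derivative (Polynomial.monomial l a) =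
        Polynomial.monomial l (a * l) := by
      cases l with
      | zero => simp
      | succ l => rw [Polynomial.derivative_monomial, Polynomial.X_mul_monomial]; simp
    rw [h2, Polynomial.X_mul_monomial, fallingEval_add, fallingEval_monomial,
      fallingEval_monomial, fallingEval_monomial, Nat.descFactorial_succ]
    rcases le_or_gt l n with h | h
    · push_cast [h]
      ring
    · simp [Nat.descFactorial_of_lt h]

theorem exists_abs_fallingEval_le (P : ℝ[X]) :
    ∃ (A : ℝ) (C : ℕ), 0 ≤ A ∧ ∀ n : ℕ, |fallingEval P n| ≤ A * ((n : ℝ) + 1) ^ C := by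
  induction P using Polynomial.induction_on' with
  | add P Q hP hQ =>
    obtain ⟨A, C, hA, hP⟩ := hP
    obtain ⟨B, D, hB, hQ⟩ := hQ
    refine ⟨A + B, max C D, by positivity, fun n => ?_⟩
    have h1 : (1 : ℝ) ≤ (n : ℝ) + 1 := by simp
    rw [fallingEval_add, add_mul]
    refine (abs_add_le _ _).trans (add_le_add ((hP n).trans ?_) ((hQ n).trans ?_))
    · gcongr
      exact le_max_left _ _
    · gcongr
      exact le_max_right _ _
  | monomial l a =>
    refine ⟨|a|, l, abs_nonneg a, fun n => ?_⟩
    rw [fallingEval_monomial, abs_mul, Nat.abs_cast]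
    gcongr
    calc (n.descFactorial l : ℝ) ≤ (n : ℝ) ^ l := by exact_mod_cast n.descFactorial_le_pow l
      _ ≤ _ := by gcongr; simp

/-! ### Expansions to a given order -/

/-- The term of order `m` of the expansion encoded by a series without negative powers of `z`. -/
def natTerm (α : ℝ) (β : ℕ) (F : ℝ[X]⟦X⟧) (m n : ℕ) : ℝ :=
  (α ^ (m * n))⁻¹ * (α ^ ((m : ℝ) * ((m : ℝ) - 1) / 2 / (β : ℝ)) *
    fallingEval (PowerSeries.coeff m F) n)

/-- The sequence `y` agrees with the expansion encoded by `F` up to an error of order `α ^ (-R n)`,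
a factor of polynomial growth being neglected. -/
def HasExpansionTo (α : ℝ) (β : ℕ) (y : ℕ → ℝ) (F : ℝ[X]⟦X⟧) (R : ℕ) : Prop :=
  IsSmall α R fun n => y n / α ^ (β * n.choose 2) - ∑ m ∈ Finset.range R, natTerm α β F m n

theorem natTerm_add (α : ℝ) (β : ℕ) (F G : ℝ[X]⟦X⟧) (m n : ℕ) :
    natTerm α β (F + G) m n = natTerm α β F m n + natTerm α β G m n := by
  rw [natTerm, map_add, fallingEval_add, natTerm, natTerm]
  ring

theorem natTerm_C_mul (α : ℝ) (β : ℕ) (c : ℝ) (F : ℝ[X]⟦X⟧) (m n : ℕ) :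
    natTerm α β (PowerSeries.C (Polynomial.C c) * F) m n = c * natTerm α β F m n := by
  rw [natTerm, PowerSeries.coeff_C_mul, fallingEval_C_mul, natTerm]
  ring

theorem isSmall_natTerm {α : ℝ} (hα : 1 < α) (β : ℕ) (F : ℝ[X]⟦X⟧) (m : ℕ) :
    IsSmall α m (natTerm α β F m) := by
  obtain ⟨A, C, hA, h⟩ := exists_abs_fallingEval_le (PowerSeries.coeff m F)
  have hα0 : 0 < α := by linarith
  refine ⟨C, IsBigO.of_bound (α ^ ((m : ℝ) * ((m : ℝ) - 1) / 2 / (β : ℝ)) * A)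
    (Eventually.of_forall fun n => ?_)⟩
  have hc : 0 ≤ α ^ ((m : ℝ) * ((m : ℝ) - 1) / 2 / (β : ℝ)) := (Real.rpow_pos_of_pos hα0 _).le
  rw [natTerm, norm_mul, norm_mul, Real.norm_of_nonneg (by positivity : 0 ≤ (α ^ (m * n))⁻¹),
    Real.norm_of_nonneg hc, Real.norm_eq_abs,
    Real.norm_of_nonneg (by positivity : 0 ≤ ((n : ℝ) + 1) ^ C / α ^ (m * n))]
  calc _ ≤ (α ^ (m * n))⁻¹ * (α ^ ((m : ℝ) * ((m : ℝ) - 1) / 2 / (β : ℝ)) *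
        (A * ((n : ℝ) + 1) ^ C)) := by gcongr; exact h n
    _ = _ := by ring

section
variable {α : ℝ} {β : ℕ} {y z : ℕ → ℝ} {F G : ℝ[X]⟦X⟧} {R : ℕ}

theorem HasExpansionTo.add (hy : HasExpansionTo α β y F R) (hz : HasExpansionTo α β z G R) :
    HasExpansionTo α β (fun n => y n + z n) (F + G) R := by
  refine (IsSmall.add hy hz).congr (Eventually.of_forall fun n => ?_)
  simp only [natTerm_add, Finset.sum_add_distrib]
  ring

theorem HasExpansionTo.const_mul (c : ℝ) (hy : HasExpansionTo α β y F R) :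
    HasExpansionTo α β (fun n => c * y n) (PowerSeries.C (Polynomial.C c) * F) R := by
  refine (IsSmall.const_mul c hy).congr (Eventually.of_forall fun n => ?_)
  simp only [natTerm_C_mul, ← Finset.mul_sum]
  ring

theorem HasExpansionTo.neg (hy : HasExpansionTo α β y F R) :
    HasExpansionTo α β (fun n => -y n) (-F) R := by
  simpa using hy.const_mul (-1)

theorem HasExpansionTo.sub (hy : HasExpansionTo α β y F R) (hz : HasExpansionTo α β z G R) :
    HasExpansionTo α β (fun n => y n - z n) (F - G) R := by
  simpa only [sub_eq_add_neg] using hy.add hz.neg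

theorem hasExpansionTo_zero : HasExpansionTo α β (fun _ => 0) 0 R := by
  simpa [HasExpansionTo, natTerm, fallingEval] using isSmall_zero α R

theorem HasExpansionTo.sum {ι : Type*} (s : Finset ι) {y : ι → ℕ → ℝ} {F : ι → ℝ[X]⟦X⟧}
    (h : ∀ i ∈ s, HasExpansionTo α β (y i) (F i) R) :
    HasExpansionTo α β (fun n => ∑ i ∈ s, y i n) (∑ i ∈ s, F i) R := by
  classical
  induction s using Finset.induction_on with
  | empty => simpa using hasExpansionTo_zero
  | insert i s hi ih =>
    simp only [Finset.sum_insert hi]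
    exact (h i (Finset.mem_insert_self i s)).add
      (ih fun j hj => h j (Finset.mem_insert_of_mem hj))

theorem HasExpansionTo.congr_coeff (hy : HasExpansionTo α β y F R)
    (h : ∀ m < R, PowerSeries.coeff m F = PowerSeries.coeff m G) : HasExpansionTo α β y G R := by
  refine IsSmall.congr hy (Eventually.of_forall fun n => ?_)
  congr 1
  refine Finset.sum_congr rfl fun m hm => ?_
  rw [natTerm, natTerm, h m (Finset.mem_range.1 hm)]

theorem HasExpansionTo.mono (hα : 1 < α) {S : ℕ} (hS : S ≤ R) (hy : HasExpansionTo α β y F R) :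
    HasExpansionTo α β y F S := by
  obtain ⟨d, rfl⟩ := Nat.exists_eq_add_of_le hS
  induction d with
  | zero => exact hy
  | succ d ih =>
    refine ih (Nat.le_add_right _ _) ?_
    have h := (IsSmall.mono hα (Nat.le_succ _) hy).add (isSmall_natTerm hα β F (S + d))
    refine h.congr (Eventually.of_forall fun n => ?_)
    simp only [← add_assoc, Finset.sum_range_succ]
    ring

theorem HasExpansionTo.add_isSmall (hy : HasExpansionTo α β y F R)
    (hz : IsSmall α R fun n => (z n - y n) / α ^ (β * n.choose 2)) : HasExpansionTo α β z F R := by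
  refine (IsSmall.add hy hz).congr (Eventually.of_forall fun n => ?_)
  ring

theorem hasExpansionTo_zero_iff :
    HasExpansionTo α β y F 0 ↔ IsSmall α 0 fun n => y n / α ^ (β * n.choose 2) := by
  simp [HasExpansionTo]

theorem HasExpansionTo.isSmall (hy : HasExpansionTo α β y F 0) :
    IsSmall α 0 fun n => y n / α ^ (β * n.choose 2) := hasExpansionTo_zero_iff.1 hy

/-- The series `(α ^ ((β + 1) / 2) z ^ β w) ^ k / k!`, times `F`. -/
def shiftSeries (α : ℝ) (β k : ℕ) (F : ℝ[X]⟦X⟧) : ℝ[X]⟦X⟧ :=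
  PowerSeries.C (Polynomial.C (k.factorial : ℝ)⁻¹) *
    (PowerSeries.monomial β (Polynomial.C (α ^ (((β : ℝ) + 1) / 2)) * Polynomial.X) ^ k * F)

theorem coeff_shiftSeries_add (α : ℝ) (β k m : ℕ) (F : ℝ[X]⟦X⟧) :
    PowerSeries.coeff (m + β * k) (shiftSeries α β k F) =
      Polynomial.C ((k.factorial : ℝ)⁻¹ * (α ^ (((β : ℝ) + 1) / 2)) ^ k) *
        (Polynomial.X ^ k * PowerSeries.coeff m F) := by
  rw [shiftSeries, PowerSeries.coeff_C_mul, PowerSeries.monomial_eq_C_mul_X_pow, mul_pow, ← pow_mul,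
    mul_assoc, ← map_pow, PowerSeries.coeff_C_mul, PowerSeries.coeff_X_pow_mul]
  simp only [map_mul, map_pow, mul_pow]
  ring

theorem coeff_shiftSeries_of_lt (α : ℝ) (β k m : ℕ) (F : ℝ[X]⟦X⟧) (h : m < β * k) :
    PowerSeries.coeff m (shiftSeries α β k F) = 0 := by
  rw [shiftSeries, PowerSeries.coeff_C_mul, PowerSeries.monomial_eq_C_mul_X_pow, mul_pow, ← pow_mul,
    mul_assoc, ← map_pow, PowerSeries.coeff_C_mul, PowerSeries.coeff_X_pow_mul', if_neg (by omega)]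
  simp

/-- With `n = k + j`, the quotient of `α ^ (β C(n,2))` and `α ^ (β C(j,2))` is
`α ^ (β (C(k,2) + k j))`, which accounts for the exponent `(β + 1) / 2` in `shiftSeries`. -/
theorem natTerm_shiftSeries (hα : 1 < α) (hβ : β ≠ 0) (F : ℝ[X]⟦X⟧) (k m j : ℕ) :
    natTerm α β (shiftSeries α β k F) (m + β * k) (k + j) =
      ((k + j).choose k : ℝ) / α ^ (β * (k.choose 2 + k * j)) * natTerm α β F m j := by
  have hα0 : 0 < α := by linarith
  have h := choose_mul_fallingEval (PowerSeries.coeff m F) (k + j) k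
  rw [Nat.add_sub_cancel_left] at h
  have hk : ((k.choose 2 : ℕ) : ℝ) = k * (k - 1) / 2 := Nat.cast_choose_two ℝ k
  rw [natTerm, coeff_shiftSeries_add, fallingEval_C_mul, natTerm]
  have e : (α ^ ((m + β * k) * (k + j)))⁻¹ *
      (α ^ (((m + β * k : ℕ) : ℝ) * (((m + β * k : ℕ) : ℝ) - 1) / 2 / (β : ℝ)) *
        (α ^ (((β : ℝ) + 1) / 2)) ^ k) =
      (α ^ (β * (k.choose 2 + k * j)))⁻¹ * ((α ^ (m * j))⁻¹ *
        α ^ ((m : ℝ) * ((m : ℝ) - 1) / 2 / (β : ℝ))) := by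
    simp only [← Real.rpow_natCast, ← Real.rpow_neg hα0.le, ← Real.rpow_mul hα0.le,
      ← Real.rpow_add hα0]
    congr 1
    push_cast
    rw [hk]
    have : (β : ℝ) ≠ 0 := by exact_mod_cast hβ
    field_simp
    ring
  generalize α ^ (((m + β * k : ℕ) : ℝ) * (((m + β * k : ℕ) : ℝ) - 1) / 2 / (β : ℝ)) = p at e ⊢
  generalize α ^ ((m : ℝ) * ((m : ℝ) - 1) / 2 / (β : ℝ)) = q at e ⊢
  generalize (α ^ (((β : ℝ) + 1) / 2)) ^ k = r at e ⊢
  rw [div_eq_mul_inv]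
  linear_combination
    (k.factorial : ℝ)⁻¹ * fallingEval (Polynomial.X ^ k * PowerSeries.coeff m F) (k + j) * e -
      ((α ^ (β * (k.choose 2 + k * j)))⁻¹ * ((α ^ (m * j))⁻¹ * q)) * h

/-- The term of index `k` at one end of a binomial convolution, whose order exceeds that of `y` by
`β k`. -/
theorem HasExpansionTo.shift (hα : 1 < α) (hβ : β ≠ 0) (hy : HasExpansionTo α β y F R) (k : ℕ) :
    HasExpansionTo α β (fun n => (n.choose k : ℝ) * y (n - k)) (shiftSeries α β k F)
      (R + β * k) := by
  have h := ((IsSmall.shift hα hy k (β * k)).const_mul (α ^ (β * k.choose 2))⁻¹).bounded_mul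
    (g := fun n => (n.choose k : ℝ)) k fun n => by
      rw [Nat.abs_cast]
      calc (n.choose k : ℝ) ≤ (n : ℝ) ^ k := by exact_mod_cast n.choose_le_pow k
        _ ≤ _ := by gcongr; simp
  refine h.congr ?_
  have hα0 : 0 < α := by linarith
  filter_upwards [eventually_ge_atTop k] with n hn
  obtain ⟨j, rfl⟩ := Nat.exists_eq_add_of_le hn
  rw [add_comm R, Finset.sum_range_add, Finset.sum_eq_zero (s := Finset.range (β * k)), zero_add]
  · simp only [add_comm (β * k), natTerm_shiftSeries hα hβ, ← Finset.mul_sum,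
      Nat.add_sub_cancel_left]
    rw [choose_two_add]
    have : α ^ (β * (k.choose 2 + j.choose 2 + k * j)) =
        α ^ (β * k.choose 2) * α ^ (β * k * j) * α ^ (β * j.choose 2) := by ring
    rw [this, show α ^ (β * (k.choose 2 + k * j)) = α ^ (β * k.choose 2) * α ^ (β * k * j) by ring]
    field_simp
  · intro m hm
    rw [natTerm, coeff_shiftSeries_of_lt _ _ _ _ _ (Finset.mem_range.1 hm)]
    simp [fallingEval]

end

/-! ### Products and quotients of expansions -/

theorem hasSubst_monomial {k : ℕ} (hk : k ≠ 0) (p : ℝ[X]) :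
    PowerSeries.HasSubst (PowerSeries.monomial k p : ℝ[X]⟦X⟧) :=
  PowerSeries.HasSubst.monomial' hk p

/-- The substitution of `α ^ ((β + 1) / 2) z ^ β w` for the variable, through which initial
coefficients of one factor act on the expansion of the other factor of a product. -/
def dilate (α : ℝ) {β : ℕ} (hβ : β ≠ 0) : ℝ⟦X⟧ →ₐ[ℝ] ℝ[X]⟦X⟧ :=
  PowerSeries.substAlgHom
    (hasSubst_monomial hβ (Polynomial.C (α ^ (((β : ℝ) + 1) / 2)) * Polynomial.X))

section
variable {α : ℝ} {β : ℕ} {y z : ℕ → ℝ} {F G : ℝ[X]⟦X⟧} {R : ℕ}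

theorem dilate_X (hβ : β ≠ 0) : dilate α hβ PowerSeries.X =
    PowerSeries.monomial β (Polynomial.C (α ^ (((β : ℝ) + 1) / 2)) * Polynomial.X) := by
  rw [dilate, PowerSeries.coe_substAlgHom, PowerSeries.subst_X (hasSubst_monomial hβ _)]

theorem dilate_C (hβ : β ≠ 0) (c : ℝ) :
    dilate α hβ (PowerSeries.C c) = PowerSeries.C (Polynomial.C c) := by
  have h := (dilate α hβ).commutes c
  rw [PowerSeries.algebraMap_apply, PowerSeries.algebraMap_apply] at h
  exact h

/-- Below order `β (K + 1)`, only the coefficients of index at most `K` of the dilated series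
matter. -/
theorem coeff_dilate_mul (hβ : β ≠ 0) (y : ℕ → ℝ) {K m : ℕ} (h : m < β * (K + 1)) :
    PowerSeries.coeff m (dilate α hβ (realExpGF y) * G) = PowerSeries.coeff m
      (∑ k ∈ Finset.range (K + 1), PowerSeries.C (Polynomial.C (y k)) * shiftSeries α β k G) := by
  set T : ℝ⟦X⟧ := ∑ k ∈ Finset.range (K + 1),
    PowerSeries.C (y k * (k.factorial : ℝ)⁻¹) * PowerSeries.X ^ k with hT
  have h1 : ∑ k ∈ Finset.range (K + 1), PowerSeries.C (Polynomial.C (y k)) * shiftSeries α β k G =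
      dilate α hβ T * G := by
    rw [hT, map_sum, Finset.sum_mul]
    refine Finset.sum_congr rfl fun k _ => ?_
    rw [map_mul, map_pow, dilate_X, dilate_C, shiftSeries, Polynomial.C_mul,
      map_mul PowerSeries.C]
    ring
  obtain ⟨B, hB⟩ : (PowerSeries.X : ℝ⟦X⟧) ^ (K + 1) ∣ realExpGF y - T := by
    rw [PowerSeries.X_pow_dvd_iff]
    intro i hi
    rw [map_sub, hT, map_sum, coeff_realExpGF]
    simp only [PowerSeries.coeff_C_mul_X_pow]
    rw [Finset.sum_ite_eq, if_pos (Finset.mem_range.2 hi), div_eq_mul_inv, sub_self]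
  have h2 : dilate α hβ (realExpGF y) * G = dilate α hβ T * G + PowerSeries.X ^ (β * (K + 1)) *
      (PowerSeries.C ((Polynomial.C (α ^ (((β : ℝ) + 1) / 2)) * Polynomial.X) ^ (K + 1)) *
        dilate α hβ B * G) := by
    rw [sub_eq_iff_eq_add.1 hB, map_add, map_mul, map_pow, dilate_X,
      PowerSeries.monomial_eq_C_mul_X_pow, mul_pow, ← pow_mul, ← map_pow]
    ring
  rw [h1, h2, map_add, PowerSeries.coeff_X_pow_mul', if_neg (by omega), add_zero]

theorem HasExpansionTo.sum_shift (hα : 1 < α) (hβ : β ≠ 0) (y : ℕ → ℝ) {S : ℕ} (s : Finset ℕ)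
    (hs : ∀ k ∈ s, R ≤ S + β * k) (hz : HasExpansionTo α β z G S) :
    HasExpansionTo α β (fun n => ∑ k ∈ s, (n.choose k : ℝ) * (y k * z (n - k)))
      (∑ k ∈ s, PowerSeries.C (Polynomial.C (y k)) * shiftSeries α β k G) R := by
  have h := HasExpansionTo.sum s fun k hk =>
    ((hz.shift hα hβ k).const_mul (y k)).mono hα (hs k hk)
  simpa only [mul_left_comm] using h

/-- In a binomial convolution, the terms far from both ends are negligible. -/
theorem exists_isSmall_binomConv_sub (hα : 1 < α) (hβ : β ≠ 0)
    (hy : IsSmall α 0 fun n => y n / α ^ (β * n.choose 2))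
    (hz : IsSmall α 0 fun n => z n / α ^ (β * n.choose 2)) (R : ℕ) :
    ∃ K, R ≤ K ∧ IsSmall α R fun n => (binomConv y z n -
      (∑ k ∈ Finset.range (K + 1), (n.choose k : ℝ) * (y k * z (n - k)) +
        ∑ k ∈ Finset.range (K + 1), (n.choose k : ℝ) * (z k * y (n - k)))) /
          α ^ (β * n.choose 2) := by
  have hα0 : 0 < α := by linarith
  obtain ⟨A, C, hA, hy⟩ := hy.exists_bound
  obtain ⟨B, D, hB, hz⟩ := hz.exists_bound
  obtain ⟨L, hL⟩ := pow_unbounded_of_one_lt (2 * α ^ R) hα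
  -- `α ^ K` outweighs both `α ^ R` and the sum `2 ^ n` of the binomial coefficients.
  set K := max L R with hK
  have hKα : 2 * α ^ R ≤ α ^ K := hL.le.trans (pow_le_pow_right₀ hα.le (le_max_left _ _))
  refine ⟨K, le_max_right _ _, C + D, IsBigO.of_bound (A * B * α ^ (K * K)) ?_⟩
  filter_upwards [eventually_ge_atTop (2 * K + 2)] with n hn
  have hsplit : binomConv y z n -
      (∑ k ∈ Finset.range (K + 1), (n.choose k : ℝ) * (y k * z (n - k)) +
        ∑ k ∈ Finset.range (K + 1), (n.choose k : ℝ) * (z k * y (n - k))) =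
      ∑ k ∈ Finset.Ico (K + 1) (n - K), (n.choose k : ℝ) * (y k * z (n - k)) := by
    have h1 : ∑ k ∈ Finset.range (K + 1), (n.choose k : ℝ) * (z k * y (n - k)) =
        ∑ k ∈ Finset.Ico (n - K) (n + 1), (n.choose k : ℝ) * (y k * z (n - k)) := by
      have h := Finset.sum_Ico_reflect (fun k => (n.choose k : ℝ) * (y k * z (n - k))) 0
        (by omega : K + 1 ≤ n + 1)
      rw [Nat.add_sub_add_right, Nat.sub_zero] at h
      rw [← h, Finset.range_eq_Ico]
      refine Finset.sum_congr rfl fun k hk => ?_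
      have hk : k ≤ n := by
        have := (Finset.mem_Ico.1 hk).2
        omega
      rw [Nat.choose_symm hk, Nat.sub_sub_self hk, mul_comm (z _)]
    rw [binomConv, h1, Finset.range_eq_Ico,
      ← Finset.sum_Ico_consecutive _ (Nat.zero_le (K + 1)) (by omega : K + 1 ≤ n + 1),
      ← Finset.sum_Ico_consecutive _ (by omega : K + 1 ≤ n - K) (by omega : n - K ≤ n + 1)]
    rw [Finset.range_eq_Ico]
    ring
  have hterm : ∀ k ∈ Finset.Ico (K + 1) (n - K),
      |(n.choose k : ℝ) * (y k * z (n - k)) / α ^ (β * n.choose 2)| ≤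
        n.choose k * (A * B * ((n : ℝ) + 1) ^ (C + D) * (α ^ (K * K) / (α ^ K) ^ n)) := by
    intro k hk
    obtain ⟨hk1, hk2⟩ := Finset.mem_Ico.1 hk
    obtain ⟨a, rfl⟩ := Nat.exists_eq_add_of_le (by omega : K ≤ k)
    obtain ⟨b, rfl⟩ := Nat.exists_eq_add_of_le (by omega : (K + a) + K ≤ n)
    have e : K + a + K + b - (K + a) = K + b := by omega
    have e2 : K + a + K + b = (K + a) + (K + b) := by ring
    rw [e]
    set k := K + a
    set l := K + b
    -- Both `k` and `l = n - k` are at least `K`, hence `k l ≥ K (n - K)`.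
    have hkl : α ^ (K * (k + l)) ≤ α ^ (K * K) * α ^ (β * (k * l)) := by
      rw [← pow_add]
      refine pow_le_pow_right₀ hα.le ?_
      have h1 : k * l ≤ β * (k * l) := Nat.le_mul_of_pos_left _ (Nat.pos_of_ne_zero hβ)
      have h2 : K * (k + l) ≤ K * K + k * l := by
        simp only [k, l]
        nlinarith [Nat.zero_le (a * b)]
      omega
    have hyk := hy k
    have hzl := hz l
    rw [abs_div, abs_of_pos (by positivity : 0 < α ^ (β * k.choose 2)),
      div_le_iff₀ (by positivity)] at hyk
    rw [abs_div, abs_of_pos (by positivity : 0 < α ^ (β * l.choose 2)),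
      div_le_iff₀ (by positivity)] at hzl
    rw [e2, abs_div, abs_mul, abs_mul, Nat.abs_cast,
      abs_of_pos (by positivity : 0 < α ^ (β * (k + l).choose 2)), mul_div_assoc]
    refine mul_le_mul_of_nonneg_left ?_ (Nat.cast_nonneg _)
    have hk1 : (k : ℝ) + 1 ≤ ((k + l : ℕ) : ℝ) + 1 := by push_cast; simp
    have hl1 : (l : ℝ) + 1 ≤ ((k + l : ℕ) : ℝ) + 1 := by push_cast; simp
    rw [div_le_iff₀ (by positivity)]
    calc |y k| * |z l| ≤ (A * ((k : ℝ) + 1) ^ C * α ^ (β * k.choose 2)) *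
          (B * ((l : ℝ) + 1) ^ D * α ^ (β * l.choose 2)) := by gcongr
      _ ≤ (A * (((k + l : ℕ) : ℝ) + 1) ^ C * α ^ (β * k.choose 2)) *
          (B * (((k + l : ℕ) : ℝ) + 1) ^ D * α ^ (β * l.choose 2)) := by gcongr
      _ = A * B * (((k + l : ℕ) : ℝ) + 1) ^ (C + D) *
          (α ^ (β * k.choose 2) * α ^ (β * l.choose 2)) * 1 := by ring
      _ ≤ A * B * (((k + l : ℕ) : ℝ) + 1) ^ (C + D) *
          (α ^ (β * k.choose 2) * α ^ (β * l.choose 2)) *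
            (α ^ (K * K) * α ^ (β * (k * l)) / (α ^ K) ^ (k + l)) := by
          gcongr
          rw [one_le_div (by positivity), ← pow_mul]
          exact hkl
      _ = _ := by
          rw [choose_two_add k l]
          ring
  rw [hsplit, Finset.sum_div, Real.norm_eq_abs, Real.norm_of_nonneg (by positivity)]
  calc _ ≤ ∑ k ∈ Finset.Ico (K + 1) (n - K), n.choose k *
        (A * B * ((n : ℝ) + 1) ^ (C + D) * (α ^ (K * K) / (α ^ K) ^ n)) :=
        (Finset.abs_sum_le_sum_abs _ _).trans (Finset.sum_le_sum hterm)
    _ ≤ ∑ k ∈ Finset.range (n + 1), n.choose k *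
        (A * B * ((n : ℝ) + 1) ^ (C + D) * (α ^ (K * K) / (α ^ K) ^ n)) := by
        refine Finset.sum_le_sum_of_subset_of_nonneg (fun k hk => ?_) fun k _ _ => by positivity
        have := (Finset.mem_Ico.1 hk).2
        exact Finset.mem_range.2 (by omega)
    _ = A * B * α ^ (K * K) * ((n : ℝ) + 1) ^ (C + D) * (2 ^ n / (α ^ K) ^ n) := by
        rw [← Finset.sum_mul, ← Nat.cast_sum, Nat.sum_range_choose]
        push_cast
        ring
    _ ≤ A * B * α ^ (K * K) * ((n : ℝ) + 1) ^ (C + D) * (1 / α ^ (R * n)) := by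
        refine mul_le_mul_of_nonneg_left ?_ (by positivity)
        rw [div_le_div_iff₀ (by positivity) (by positivity), one_mul, pow_mul, ← mul_pow]
        gcongr
    _ = _ := by ring

/-- The expansion of a binomial convolution. -/
theorem hasExpansionTo_binomConv (hα : 1 < α) (hβ : β ≠ 0) (hy : ∀ R, HasExpansionTo α β y F R)
    (hz : ∀ R, HasExpansionTo α β z G R) (R : ℕ) :
    HasExpansionTo α β (binomConv y z)
      (dilate α hβ (realExpGF y) * G + dilate α hβ (realExpGF z) * F) R := by
  obtain ⟨K, hRK, hK⟩ := exists_isSmall_binomConv_sub hα hβ (hy 0).isSmall (hz 0).isSmall R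
  have h1 := (hz R).sum_shift (R := R) hα hβ y (Finset.range (K + 1)) fun k _ => Nat.le_add_right _ _
  have h2 := (hy R).sum_shift (R := R) hα hβ z (Finset.range (K + 1)) fun k _ => Nat.le_add_right _ _
  refine ((h1.add h2).add_isSmall hK).congr_coeff fun m hm => ?_
  have hm : m < β * (K + 1) := by
    have : K + 1 ≤ β * (K + 1) := Nat.le_mul_of_pos_left _ (Nat.pos_of_ne_zero hβ)
    omega
  rw [map_add, map_add, coeff_dilate_mul hβ y hm, coeff_dilate_mul hβ z hm]

theorem shiftSeries_zero (F : ℝ[X]⟦X⟧) : shiftSeries α β 0 F = F := by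
  simp [shiftSeries]

/-- If `binomConv a y = h` with `a₀ = 1`, where `a` and `h` have expansions and `y` has at most the expected
growth, then `y` has an expansion as well: the recurrence for `y` expresses its expansion to order
`R + 1` through the expansions of `a` and `h` and the expansion of `y` to order `R`. -/
theorem hasExpansionTo_of_binomConv_eq (hα : 1 < α) (hβ : β ≠ 0) {a h : ℕ → ℝ}
    {Fa Fh Fy : ℝ[X]⟦X⟧} (ha : ∀ R, HasExpansionTo α β a Fa R)
    (hh : ∀ R, HasExpansionTo α β h Fh R) (ha0 : a 0 = 1)
    (hy : IsSmall α 0 fun n => y n / α ^ (β * n.choose 2)) (hay : ∀ n, binomConv a y n = h n)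
    (hF : dilate α hβ (realExpGF a) * Fy = Fh - dilate α hβ (realExpGF y) * Fa) (R : ℕ) :
    HasExpansionTo α β y Fy R := by
  induction R with
  | zero => exact hasExpansionTo_zero_iff.2 hy
  | succ R ih =>
    obtain ⟨K, hRK, hK⟩ := exists_isSmall_binomConv_sub hα hβ (ha 0).isSmall hy (R + 1)
    have hβ1 : ∀ k, k ≤ β * k := fun k => Nat.le_mul_of_pos_left _ (Nat.pos_of_ne_zero hβ)
    have h1 := ih.sum_shift (R := R + 1) hα hβ a (Finset.Ico 1 (K + 1)) fun k hk => by
      have := hβ1 k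
      have := (Finset.mem_Ico.1 hk).1
      omega
    have h2 := (ha (R + 1)).sum_shift (R := R + 1) hα hβ y (Finset.range (K + 1))
      fun k _ => Nat.le_add_right _ _
    refine ((((hh (R + 1)).sub h1).sub h2).add_isSmall (hK.neg.congr ?_)).congr_coeff fun m hm => ?_
    · refine Eventually.of_forall fun n => ?_
      rw [Finset.range_eq_Ico, Finset.sum_eq_sum_Ico_succ_bot (Nat.succ_pos K), hay, ha0,
        ← Finset.range_eq_Ico]
      simp only [Nat.choose_zero_right, Nat.cast_one, one_mul, Nat.sub_zero, zero_add]
      ring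
    · have hm : m < β * (K + 1) := by
        have := hβ1 (K + 1)
        omega
      have e1 := coeff_dilate_mul (α := α) (G := Fy) hβ a hm
      have e2 := coeff_dilate_mul (α := α) (G := Fa) hβ y hm
      rw [Finset.range_eq_Ico, Finset.sum_eq_sum_Ico_succ_bot (Nat.succ_pos K), hF, ha0,
        shiftSeries_zero, map_sub, e2] at e1
      simp only [map_one, one_mul, zero_add, map_add] at e1
      rw [map_sub, map_sub]
      linear_combination e1

/-- The operator on expansions that corresponds to multiplying the `n`-th term of a sequence by `n`,
namely `F ↦ w F + w ∂F/∂w`. -/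
def thetaExpansion (F : ℝ[X]⟦X⟧) : ℝ[X]⟦X⟧ :=
  PowerSeries.mk fun m => Polynomial.X * PowerSeries.coeff m F +
    Polynomial.X * Polynomial.derivative (PowerSeries.coeff m F)

theorem natTerm_thetaExpansion (F : ℝ[X]⟦X⟧) (m n : ℕ) :
    natTerm α β (thetaExpansion F) m n = n * natTerm α β F m n := by
  rw [natTerm, thetaExpansion, PowerSeries.coeff_mk, fallingEval_X_mul_add, natTerm]
  ring

/-- Division by `n` does no harm here: it keeps the error small, and on the expansion it undoes
`thetaExpansion`. -/
theorem hasExpansionTo_thetaExpansion_iff :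
    HasExpansionTo α β (fun n => n * y n) (thetaExpansion F) R ↔ HasExpansionTo α β y F R := by
  have h : ∀ n : ℕ, n * y n / α ^ (β * n.choose 2) -
      ∑ m ∈ Finset.range R, natTerm α β (thetaExpansion F) m n =
      n * (y n / α ^ (β * n.choose 2) - ∑ m ∈ Finset.range R, natTerm α β F m n) := by
    intro n
    simp only [natTerm_thetaExpansion, ← Finset.mul_sum]
    ring
  simp only [HasExpansionTo, h]
  constructor
  · rintro ⟨C, hC⟩
    refine ⟨C, (IsBigO.of_bound 1 ?_).trans hC⟩
    filter_upwards [eventually_ge_atTop 1] with n hn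
    have : (1 : ℝ) ≤ n := by exact_mod_cast hn
    rw [one_mul, norm_mul, Real.norm_natCast]
    exact le_mul_of_one_le_left (norm_nonneg _) this
  · intro h
    refine IsSmall.bounded_mul h 1 fun n => ?_
    rw [Nat.abs_cast, pow_one]
    simp

end

/-! ### The expansion of strongly connected digraphs -/

section
variable {α : ℝ} {β : ℕ} {A B : ℝ⟦X⟧} {F G : ℝ[X]⟦X⟧}

/-- `A` is graphically divergent, and the power series `F` is its coefficient generating function. -/
def HasExpansion (α : ℝ) (β : ℕ) (A : ℝ⟦X⟧) (F : ℝ[X]⟦X⟧) : Prop :=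
  ∀ R, HasExpansionTo α β (fun n => (n.factorial : ℝ) * PowerSeries.coeff n A) F R

theorem hasExpansion_realExpGF {y : ℕ → ℝ} :
    HasExpansion α β (realExpGF y) F ↔ ∀ R, HasExpansionTo α β y F R := by
  simp only [HasExpansion, factorial_mul_coeff_realExpGF]

theorem HasExpansion.add (hA : HasExpansion α β A F) (hB : HasExpansion α β B G) :
    HasExpansion α β (A + B) (F + G) := fun R => by
  simpa only [map_add, mul_add] using (hA R).add (hB R)

theorem HasExpansion.sub (hA : HasExpansion α β A F) (hB : HasExpansion α β B G) :
    HasExpansion α β (A - B) (F - G) := fun R => by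
  simpa only [map_sub, mul_sub] using (hA R).sub (hB R)

theorem HasExpansion.smul (c : ℝ) (hA : HasExpansion α β A F) :
    HasExpansion α β (c • A) (c • F) := fun R => by
  have h := (hA R).const_mul c
  rw [show c • F = PowerSeries.C (Polynomial.C c) * F by
    ext1 n
    rw [PowerSeries.coeff_C_mul, PowerSeries.coeff_smul, Polynomial.smul_eq_C_mul]]
  simpa only [PowerSeries.coeff_smul, smul_eq_mul, mul_left_comm] using h

/-- The product rule for coefficient generating functions. -/
theorem HasExpansion.mul (hα : 1 < α) (hβ : β ≠ 0) (hA : HasExpansion α β A F)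
    (hB : HasExpansion α β B G) :
    HasExpansion α β (A * B) (dilate α hβ A * G + dilate α hβ B * F) := by
  have h := hasExpansionTo_binomConv hα hβ hA hB
  simp only [realExpGF_factorial_mul_coeff] at h
  rw [← hasExpansion_realExpGF, ← realExpGF_mul, realExpGF_factorial_mul_coeff,
    realExpGF_factorial_mul_coeff] at h
  exact h

/-! ### Hadamard products -/

/-- The Hadamard product with the exponential generating function `B`, on series without negative
powers of `z`. -/
def hadamardSeries (F : ℝ[X]⟦X⟧) (B : ℝ⟦X⟧) : ℝ[X]⟦X⟧ :=
  PowerSeries.mk fun m => ((m.factorial : ℝ) * PowerSeries.coeff m B) • PowerSeries.coeff m F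

theorem factorial_mul_coeff_graphicSet (w : ℝ) (m : ℕ) :
    (m.factorial : ℝ) * PowerSeries.coeff m (graphicSet w) = ((1 + w) ^ m.choose 2)⁻¹ := by
  rw [graphicSet, PowerSeries.coeff_mk, mul_div_cancel₀ _ (by positivity), one_div]

theorem coeff_hadamardSeries_graphicSet (w : ℝ) (m : ℕ) :
    PowerSeries.coeff m (hadamardSeries F (graphicSet w)) =
      Polynomial.C ((1 + w) ^ m.choose 2)⁻¹ * PowerSeries.coeff m F := by
  rw [hadamardSeries, PowerSeries.coeff_mk, factorial_mul_coeff_graphicSet,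
    Polynomial.smul_eq_C_mul]

/-- The multiplier `√2 ^ (-C(m,2))` compensates the different normalisations of the coefficient
generating functions of types `(2, 1)` and `(2, 2)`. -/
theorem natTerm_hadamardSeries (m n : ℕ) :
    natTerm 2 1 (hadamardSeries F (graphicSet (√2 - 1))) m n = natTerm 2 2 F m n := by
  rw [natTerm, coeff_hadamardSeries_graphicSet, fallingEval_C_mul, natTerm, add_sub_cancel,
    ← mul_assoc _ _ (fallingEval _ _)]
  congr 2
  rw [Real.sqrt_eq_rpow, ← Real.rpow_natCast, ← Real.rpow_mul two_pos.le, ← Real.rpow_neg two_pos.le,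
    ← Real.rpow_add two_pos, Nat.cast_choose_two]
  congr 1
  push_cast
  ring

/-- Dividing the `n`-th term by `2 ^ C(n,2)` turns type `(2, 2)` into type `(2, 1)`. -/
theorem hasExpansionTo_graphic_iff {y : ℕ → ℝ} {R : ℕ} :
    HasExpansionTo 2 1 (fun n => y n / 2 ^ n.choose 2)
      (hadamardSeries F (graphicSet (√2 - 1))) R ↔ HasExpansionTo 2 2 y F R := by
  simp only [HasExpansionTo, natTerm_hadamardSeries, div_div, ← pow_add, one_mul, two_mul]

theorem HasExpansion.toGraphic (hA : HasExpansion 2 2 A F) :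
    HasExpansion 2 1 (toGraphic A) (hadamardSeries F (graphicSet (√2 - 1))) := fun R => by
  simpa only [coeff_toGraphic, mul_div_assoc'] using hasExpansionTo_graphic_iff.2 (hA R)

/-! ### The operator `z d/dz` on expansions -/

/-- The derivation `w ∂/∂w`. -/
def wDeriv (F : ℝ[X]⟦X⟧) : ℝ[X]⟦X⟧ :=
  PowerSeries.mk fun m => Polynomial.X * Polynomial.derivative (PowerSeries.coeff m F)

theorem coeff_wDeriv (F : ℝ[X]⟦X⟧) (m : ℕ) : PowerSeries.coeff m (wDeriv F) =
    Polynomial.X * Polynomial.derivative (PowerSeries.coeff m F) := PowerSeries.coeff_mk _ _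

theorem wDeriv_mul (F G : ℝ[X]⟦X⟧) : wDeriv (F * G) = wDeriv F * G + F * wDeriv G := by
  ext1 m
  rw [coeff_wDeriv, PowerSeries.coeff_mul, map_add, PowerSeries.coeff_mul, PowerSeries.coeff_mul,
    Polynomial.derivative_sum, Finset.mul_sum, ← Finset.sum_add_distrib]
  refine Finset.sum_congr rfl fun p _ => ?_
  rw [coeff_wDeriv, coeff_wDeriv, Polynomial.derivative_mul]
  ring

theorem thetaExpansion_eq (F : ℝ[X]⟦X⟧) :
    thetaExpansion F = PowerSeries.C Polynomial.X * F + wDeriv F := by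
  ext1 m
  rw [thetaExpansion, PowerSeries.coeff_mk, map_add, PowerSeries.coeff_C_mul, coeff_wDeriv]

theorem coeff_shiftSeries_one (k m : ℕ) : PowerSeries.coeff m (shiftSeries α β k 1) =
    if m = β * k then
      Polynomial.C ((k.factorial : ℝ)⁻¹ * (α ^ (((β : ℝ) + 1) / 2)) ^ k) * Polynomial.X ^ k
    else 0 := by
  rcases lt_or_ge m (β * k) with h | h
  · rw [coeff_shiftSeries_of_lt _ _ _ _ _ h, if_neg h.ne]
  · obtain ⟨d, rfl⟩ := Nat.exists_eq_add_of_le' h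
    rw [coeff_shiftSeries_add, PowerSeries.coeff_one]
    rcases Nat.eq_zero_or_pos d with rfl | hd
    · simp
    · rw [if_neg hd.ne', if_neg (by omega)]
      simp

theorem coeff_dilate (hβ : β ≠ 0) (y : ℕ → ℝ) (m : ℕ) :
    PowerSeries.coeff m (dilate α hβ (realExpGF y)) = ∑ k ∈ Finset.range (m + 1), if m = β * k then
      Polynomial.C (y k * ((k.factorial : ℝ)⁻¹ * (α ^ (((β : ℝ) + 1) / 2)) ^ k)) *
        Polynomial.X ^ k else 0 := by
  have h := coeff_dilate_mul (α := α) (G := 1) hβ y (m := m) (K := m)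
    (Nat.lt_of_lt_of_le (Nat.lt_succ_self m) (Nat.le_mul_of_pos_left _ (Nat.pos_of_ne_zero hβ)))
  rw [mul_one] at h
  rw [h, map_sum]
  refine Finset.sum_congr rfl fun k _ => ?_
  rw [PowerSeries.coeff_C_mul, coeff_shiftSeries_one, mul_ite, mul_zero, ← mul_assoc,
    ← Polynomial.C_mul]

/-- Both `w` and `z` occur in the dilated variable, `w` to the first power, so that `w ∂/∂w` acts on
it like `z d/dz` before the dilation. -/
theorem wDeriv_dilate (hβ : β ≠ 0) (A : ℝ⟦X⟧) :
    wDeriv (dilate α hβ A) = dilate α hβ (theta A) := by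
  rw [← realExpGF_factorial_mul_coeff A, theta_realExpGF]
  ext1 m
  rw [coeff_wDeriv, coeff_dilate, coeff_dilate, Polynomial.derivative_sum, Finset.mul_sum]
  refine Finset.sum_congr rfl fun k _ => ?_
  split_ifs
  · rw [Polynomial.derivative_C_mul, Polynomial.derivative_X_pow]
    cases k with
    | zero => simp
    | succ k =>
      rw [Nat.add_sub_cancel, mul_assoc (((k + 1 : ℕ) : ℝ)), Polynomial.C_mul (a := ((k + 1 : ℕ) : ℝ))]
      ring
  · simp

theorem thetaExpansion_dilate_mul (hβ : β ≠ 0) (A : ℝ⟦X⟧) (F : ℝ[X]⟦X⟧) :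
    thetaExpansion (dilate α hβ A * F) =
      dilate α hβ A * thetaExpansion F + dilate α hβ (theta A) * F := by
  rw [thetaExpansion_eq, thetaExpansion_eq, wDeriv_mul, wDeriv_dilate]
  ring

theorem thetaExpansion_neg (F : ℝ[X]⟦X⟧) : thetaExpansion (-F) = -thetaExpansion F := by
  ext1 m
  simp only [thetaExpansion, PowerSeries.coeff_mk, map_neg, mul_neg]
  ring

theorem HasExpansion.theta (hA : HasExpansion α β A F) :
    HasExpansion α β (theta A) (thetaExpansion F) := fun R => by
  simpa only [coeff_theta, mul_left_comm] using hasExpansionTo_thetaExpansion_iff.2 (hA R)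

theorem HasExpansion.of_theta (hA : HasExpansion α β (DenseDigraph.theta A) (thetaExpansion F)) :
    HasExpansion α β A F := fun R => by
  refine hasExpansionTo_thetaExpansion_iff.1 ?_
  simpa only [coeff_theta, mul_left_comm] using hA R

/-- The quotient rule for coefficient generating functions. -/
theorem HasExpansion.of_mul_eq {H : ℝ⟦X⟧} {Fa Fh : ℝ[X]⟦X⟧} (hα : 1 < α) (hβ : β ≠ 0)
    (hA : HasExpansion α β A Fa) (hH : HasExpansion α β H Fh) (hA0 : PowerSeries.coeff 0 A = 1)
    (hB : IsSmall α 0 fun n => (n.factorial : ℝ) * PowerSeries.coeff n B / α ^ (β * n.choose 2))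
    (hAB : A * B = H) (hF : dilate α hβ A * F = Fh - dilate α hβ B * Fa) :
    HasExpansion α β B F := by
  refine hasExpansionTo_of_binomConv_eq hα hβ hA hH (by simpa using hA0) hB (fun n => ?_) ?_
  · rw [← hAB, ← factorial_mul_coeff_realExpGF (binomConv _ _), ← realExpGF_mul,
      realExpGF_factorial_mul_coeff, realExpGF_factorial_mul_coeff]
  · rwa [realExpGF_factorial_mul_coeff, realExpGF_factorial_mul_coeff]

end

/-! ### From graphs to strongly connected digraphs -/

theorem isSmall_of_abs_le {α : ℝ} {β : ℕ} {y : ℕ → ℝ} (hα : 1 < α)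
    (h : ∀ n, |y n| ≤ α ^ (β * n.choose 2)) : IsSmall α 0 fun n => y n / α ^ (β * n.choose 2) := by
  refine ⟨0, IsBigO.of_bound 1 (Eventually.of_forall fun n => ?_)⟩
  have : 0 < α := by linarith
  rw [norm_div, Real.norm_eq_abs, Real.norm_of_nonneg (by positivity)]
  simpa using div_le_one_of_le₀ (h n) (by positivity)

theorem hasExpansion_zero_one : HasExpansion 2 1 1 0 := by
  intro R
  refine (isSmall_zero 2 R).congr ?_
  filter_upwards [eventually_ge_atTop 1] with n hn
  rw [PowerSeries.coeff_one, if_neg (by omega)]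
  simp [natTerm, fallingEval]

theorem hasExpansion_graphs : HasExpansion 2 1 (realExpGF fun n => 2 ^ n.choose 2) 1 := by
  rw [hasExpansion_realExpGF]
  intro R
  refine HasExpansionTo.mono one_lt_two (Nat.le_succ R) ((isSmall_zero 2 _).congr ?_)
  refine Eventually.of_forall fun n => ?_
  rw [Finset.sum_range_succ', Finset.sum_eq_zero]
  · have h : fallingEval 1 n = 1 := by
      rw [← Polynomial.monomial_zero_one, fallingEval_monomial]
      simp
    rw [natTerm, PowerSeries.coeff_zero_one, h]
    simp
  · intro m _
    simp [natTerm, PowerSeries.coeff_one, fallingEval]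

/-- The coefficient generating function of `toGraphic signedUnionTotal`, the inverse of the
exponential generating function of graphs. -/
def graphicSignedUnionExpansion : ℝ[X]⟦X⟧ := -dilate 2 one_ne_zero (toGraphic signedUnionTotal) ^ 2

theorem hasExpansion_toGraphic_signedUnionTotal :
    HasExpansion 2 1 (toGraphic signedUnionTotal) graphicSignedUnionExpansion := by
  refine hasExpansion_graphs.of_mul_eq one_lt_two one_ne_zero hasExpansion_zero_one
    (by simp [coeff_realExpGF]) (isSmall_of_abs_le one_lt_two fun n => ?_)
    toGraphic_signedUnionTotal_mul ?_
  · rw [signedUnionTotal, toGraphic_realExpGF, factorial_mul_coeff_realExpGF, abs_div,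
      abs_of_pos (by positivity : (0 : ℝ) < 2 ^ n.choose 2), div_le_iff₀ (by positivity), ← pow_add]
    refine (abs_strongUnionSum_le n).trans (le_of_eq ?_)
    ring
  · have h := congrArg (dilate 2 one_ne_zero) toGraphic_signedUnionTotal_mul
    rw [map_mul, map_one] at h
    rw [graphicSignedUnionExpansion]
    linear_combination -dilate 2 one_ne_zero (toGraphic signedUnionTotal) * h

/-- The coefficient generating function of `signedUnionTotal`. -/
def signedUnionExpansion : ℝ[X]⟦X⟧ := PowerSeries.mk fun m =>
  Polynomial.C (√2 ^ m.choose 2) * PowerSeries.coeff m graphicSignedUnionExpansion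

theorem hadamardSeries_signedUnionExpansion :
    hadamardSeries signedUnionExpansion (graphicSet (√2 - 1)) = graphicSignedUnionExpansion := by
  ext1 m
  rw [coeff_hadamardSeries_graphicSet, signedUnionExpansion, PowerSeries.coeff_mk, ← mul_assoc,
    ← Polynomial.C_mul, add_sub_cancel, inv_mul_cancel₀ (by positivity), Polynomial.C_1, one_mul]

theorem hasExpansion_signedUnionTotal :
    HasExpansion 2 2 signedUnionTotal signedUnionExpansion := by
  intro R
  rw [← hasExpansionTo_graphic_iff, hadamardSeries_signedUnionExpansion]
  simpa only [coeff_toGraphic, mul_div_assoc] using hasExpansion_toGraphic_signedUnionTotal R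

/-- The coefficient generating function of `SCD`. -/
def scdExpansion : ℝ[X]⟦X⟧ := -(dilate 2 two_ne_zero signedUnionTotal⁻¹ * signedUnionExpansion)

theorem dilate_signedUnionTotal_mul_inv : dilate 2 two_ne_zero signedUnionTotal *
    dilate 2 two_ne_zero signedUnionTotal⁻¹ = 1 := by
  rw [← map_mul, PowerSeries.mul_inv_cancel, map_one]
  rw [← PowerSeries.coeff_zero_eq_constantCoeff_apply, coeff_zero_signedUnionTotal]
  exact one_ne_zero

/-- The quotient rule applies to `θ(SCD) = -θE / E`, where `E` is `signedUnionTotal`. Its hypothesis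
on the expansions is the product rule for `thetaExpansion`, applied to `𝒬E = -E(⋯) 𝒬SCD`. -/
theorem hasExpansion_SCD : HasExpansion 2 2 SCD scdExpansion := by
  refine HasExpansion.of_theta ?_
  refine hasExpansion_signedUnionTotal.of_mul_eq (H := (-1 : ℝ) • theta signedUnionTotal)
    one_lt_two two_ne_zero (hasExpansion_signedUnionTotal.theta.smul (-1))
    coeff_zero_signedUnionTotal ?_ ?_ ?_
  -- `θ(SCD)` has at most the expected growth, since there are no more strongly connected digraphs
  -- than digraphs.
  · have h : IsSmall 2 0 fun n => (strongCount n : ℝ) / 2 ^ (2 * n.choose 2) :=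
      isSmall_of_abs_le one_lt_two fun n => by
        rw [Nat.abs_cast]
        exact_mod_cast strongCount_le n
    refine (h.bounded_mul (g := fun n => (n : ℝ)) 1 fun n => by simp).congr
      (Eventually.of_forall fun n => ?_)
    rw [SCD_eq_realExpGF, theta_realExpGF, factorial_mul_coeff_realExpGF, mul_div_assoc]
  · rw [theta_signedUnionTotal, neg_smul, one_smul, neg_neg, mul_comm]
  · have h1 : signedUnionExpansion =
        -(dilate 2 two_ne_zero signedUnionTotal * scdExpansion) := by
      rw [scdExpansion]
      linear_combination -signedUnionExpansion * dilate_signedUnionTotal_mul_inv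
    have h2 := congrArg thetaExpansion h1
    rw [thetaExpansion_neg, thetaExpansion_dilate_mul, theta_signedUnionTotal, map_neg, map_mul]
      at h2
    rw [neg_smul, one_smul]
    linear_combination h2 + dilate 2 two_ne_zero (theta SCD) * h1

theorem coeff_zero_dilate {α : ℝ} {β : ℕ} (hβ : β ≠ 0) (A : ℝ⟦X⟧) :
    PowerSeries.coeff 0 (dilate α hβ A) = Polynomial.C (PowerSeries.coeff 0 A) := by
  rw [← realExpGF_factorial_mul_coeff A, coeff_dilate, coeff_realExpGF]
  simp

theorem coeff_zero_scdExpansion : PowerSeries.coeff 0 scdExpansion = 1 := by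
  have h : PowerSeries.constantCoeff signedUnionTotal = 1 := by
    rw [← PowerSeries.coeff_zero_eq_constantCoeff_apply, coeff_zero_signedUnionTotal]
  have hmul (F G : ℝ[X]⟦X⟧) : PowerSeries.coeff 0 (F * G) =
      PowerSeries.coeff 0 F * PowerSeries.coeff 0 G := by
    simp only [PowerSeries.coeff_zero_eq_constantCoeff_apply, map_mul]
  rw [scdExpansion, map_neg, hmul, signedUnionExpansion, PowerSeries.coeff_mk,
    graphicSignedUnionExpansion, map_neg, pow_two, hmul, coeff_zero_dilate,
    coeff_zero_dilate, coeff_toGraphic, coeff_zero_signedUnionTotal,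
    PowerSeries.coeff_zero_eq_constantCoeff_apply, PowerSeries.constantCoeff_inv, h]
  simp

/-! ### Coefficient generating functions as Laurent series -/

theorem zero_le_order_ofPowerSeries (F : ℝ[X]⟦X⟧) :
    0 ≤ (HahnSeries.ofPowerSeries ℤ ℝ[X] F).order := by
  by_contra! h
  have h0 : (HahnSeries.ofPowerSeries ℤ ℝ[X] F).coeff
      (HahnSeries.ofPowerSeries ℤ ℝ[X] F).order = 0 := by
    rw [PowerSeries.coeff_coe, if_pos h]
  rw [HahnSeries.coeff_order_eq_zero] at h0
  rw [h0, HahnSeries.order_zero] at h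
  exact lt_irrefl _ h

theorem natTerm_eq_expansionTerm (α : ℝ) (β : ℕ) (F : ℝ[X]⟦X⟧) (m n : ℕ) :
    expansionTerm α β (HahnSeries.ofPowerSeries ℤ ℝ[X] F) m n = natTerm α β F m n := by
  rw [expansionTerm, natTerm, HahnSeries.ofPowerSeries_apply_coeff, zpow_neg, ← Nat.cast_mul,
    zpow_natCast, Int.cast_natCast]

theorem IsSmall.isLittleO {α : ℝ} (hα : 1 < α) {r : ℕ} {f : ℕ → ℝ} (hf : IsSmall α r f) {R : ℤ}
    (hR : R < r) : f =o[atTop] fun n : ℕ => α ^ (-(R * (n : ℤ))) := by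
  obtain ⟨C, hC⟩ := hf
  have hα0 : 0 < α := by linarith
  refine hC.trans_isLittleO ?_
  have h1 : (fun n : ℕ => ((n : ℝ) + 1) ^ C) =o[atTop] fun n : ℕ => α ^ n := by
    refine IsBigO.trans_isLittleO ?_ (isLittleO_pow_const_const_pow_of_one_lt (R := ℝ) C hα)
    refine IsBigO.pow ?_ C
    refine IsBigO.of_bound 2 ?_
    filter_upwards [eventually_ge_atTop 1] with n hn
    have : (1 : ℝ) ≤ n := by exact_mod_cast hn
    rw [Real.norm_of_nonneg (by positivity), Real.norm_of_nonneg (by positivity)]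
    linarith
  have h2 := h1.mul_isBigO (isBigO_refl (fun n : ℕ => (α ^ (r * n))⁻¹) atTop)
  simp only [← div_eq_mul_inv] at h2
  refine h2.trans_isBigO (IsBigO.of_bound 1 (Eventually.of_forall fun n => ?_))
  rw [Real.norm_of_nonneg (by positivity), Real.norm_of_nonneg (by positivity), one_mul,
    ← zpow_natCast, ← zpow_natCast, ← zpow_sub₀ hα0.ne']
  refine zpow_le_zpow_right₀ hα.le ?_
  push_cast
  nlinarith [Int.natCast_nonneg n]

theorem HasExpansion.isCoefficientGF {α : ℝ} (hα : 1 < α) {β : ℕ} {A : ℝ⟦X⟧} {F : ℝ[X]⟦X⟧}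
    (h : HasExpansion α β A F) :
    IsCoefficientGF α β A (HahnSeries.ofPowerSeries ℤ ℝ[X] F) := by
  intro R
  have hIcc : Finset.Icc (0 : ℤ) R = (Finset.range (R + 1).toNat).map Nat.castEmbedding := by
    ext m
    simp only [Finset.mem_Icc, Finset.mem_map, Finset.mem_range, Nat.castEmbedding_apply]
    constructor
    · exact fun hm => ⟨m.toNat, by omega, by omega⟩
    · rintro ⟨k, hk, rfl⟩
      omega
  refine (IsSmall.isLittleO hα (h (R + 1).toNat) (by omega)).congr_left fun n => ?_
  rw [sum_expansionTerm α β _ (zero_le_order_ofPowerSeries F), hIcc, Finset.sum_map]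
  simp only [Nat.castEmbedding_apply, natTerm_eq_expansionTerm]

theorem HasExpansion.mem {α : ℝ} (hα : 1 < α) {β : ℕ} {A : ℝ⟦X⟧} {F : ℝ[X]⟦X⟧}
    (h : HasExpansion α β A F) : A ∈ graphicallyDivergent α β :=
  ⟨_, h.isCoefficientGF hα⟩

theorem HasExpansion.coefficientGF_eq {α : ℝ} (hα : 1 < α) {β : ℕ} {A : ℝ⟦X⟧} {F : ℝ[X]⟦X⟧}
    (h : HasExpansion α β A F) :
    coefficientGF α β A = HahnSeries.ofPowerSeries ℤ ℝ[X] F :=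
  (coefficientGF_eq_iff hα (h.mem hα)).2 (h.isCoefficientGF hα)

theorem substMonomial_two_one (A : ℝ⟦X⟧) : substMonomial A 2 1 =
    HahnSeries.ofPowerSeries ℤ ℝ[X] (dilate 2 one_ne_zero A) := by
  rw [substMonomial, dilate, PowerSeries.coe_substAlgHom]
  norm_num

theorem substMonomial_rpow_two (A : ℝ⟦X⟧) : substMonomial A ((2 : ℝ) ^ (3 / 2 : ℝ)) 2 =
    HahnSeries.ofPowerSeries ℤ ℝ[X] (dilate 2 two_ne_zero A) := by
  rw [substMonomial, dilate, PowerSeries.coe_substAlgHom]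
  norm_num

theorem hadamardZ_ofPowerSeries (F : ℝ[X]⟦X⟧) (B : ℝ⟦X⟧) :
    hadamardZ (HahnSeries.ofPowerSeries ℤ ℝ[X] F) B =
      HahnSeries.ofPowerSeries ℤ ℝ[X] (hadamardSeries F B) := by
  simp only [hadamardZ, hadamardSeries, HahnSeries.ofPowerSeries_apply_coeff]

theorem hadamardSeries_dilate (A : ℝ⟦X⟧) :
    hadamardSeries (dilate 2 one_ne_zero A) (graphicSet 1) =
      dilate 2 one_ne_zero (toGraphic A) := by
  ext1 m
  rw [coeff_hadamardSeries_graphicSet, ← realExpGF_factorial_mul_coeff A, toGraphic_realExpGF,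
    coeff_dilate, coeff_dilate, Finset.mul_sum]
  refine Finset.sum_congr rfl fun k _ => ?_
  split_ifs with h
  · obtain rfl : m = k := by rw [h, one_mul]
    rw [← mul_assoc, ← Polynomial.C_mul]
    congr 2
    norm_num
    ring
  · rw [mul_zero]

theorem hadamardSeries_smul (c : ℝ) (F : ℝ[X]⟦X⟧) (B : ℝ⟦X⟧) :
    hadamardSeries (c • F) B = c • hadamardSeries F B := by
  ext1 m
  simp only [hadamardSeries, PowerSeries.coeff_mk, PowerSeries.coeff_smul, smul_comm c]

/-- The coefficient generating function of `SCDHat`. -/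
def scdHatExpansion : ℝ[X]⟦X⟧ := hadamardSeries scdExpansion (graphicSet (√2 - 1))

/-- The coefficient generating function of `SHat 2`. -/
def twoExpansion : ℝ[X]⟦X⟧ := 2 * (dilate 2 one_ne_zero SCDHat * scdHatExpansion) -
  hadamardSeries (dilate 2 two_ne_zero SCD * scdExpansion) (graphicSet (√2 - 1))

/-- The coefficient generating function of `SHat 3`. -/
def threeExpansion : ℝ[X]⟦X⟧ := 3 * dilate 2 one_ne_zero SCDHat ^ 2 * scdHatExpansion -
  scdHatExpansion * hadamardSeries (dilate 2 one_ne_zero SCD ^ 2) (graphicSet 1) -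
  dilate 2 one_ne_zero SCDHat *
    hadamardSeries (2 * dilate 2 two_ne_zero SCD * scdExpansion) (graphicSet (√2 - 1)) +
  (1 / 2 : ℝ) •
    hadamardSeries (dilate 2 two_ne_zero SCD ^ 2 * scdExpansion) (graphicSet (√2 - 1))

theorem two_smul_eq (F : ℝ[X]⟦X⟧) : (2 : ℝ) • F = 2 * F := by
  rw [two_smul, two_mul]

theorem three_smul_eq (F : ℝ[X]⟦X⟧) : (3 : ℝ) • F = 3 * F := by
  rw [show (3 : ℝ) = 2 + 1 by norm_num, add_smul, two_smul, one_smul]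
  ring

theorem hasExpansion_SCDHat : HasExpansion 2 1 SCDHat scdHatExpansion := by
  rw [SCDHat_eq_toGraphic]
  exact hasExpansion_SCD.toGraphic

theorem hasExpansion_SCD_sq :
    HasExpansion 2 2 (SCD ^ 2) ((2 : ℝ) • (dilate 2 two_ne_zero SCD * scdExpansion)) := by
  rw [pow_two, two_smul]
  exact hasExpansion_SCD.mul one_lt_two two_ne_zero hasExpansion_SCD

theorem hasExpansion_SCD_cube :
    HasExpansion 2 2 (SCD ^ 3) ((3 : ℝ) • (dilate 2 two_ne_zero SCD ^ 2 * scdExpansion)) := by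
  have h := hasExpansion_SCD.mul one_lt_two two_ne_zero hasExpansion_SCD_sq
  rw [← pow_succ'] at h
  convert h using 1
  rw [two_smul_eq, three_smul_eq, map_pow]
  ring

theorem hasExpansion_SHat_two : HasExpansion 2 1 (SHat 2) twoExpansion := by
  rw [SHat_two]
  have h := (hasExpansion_SCDHat.mul one_lt_two one_ne_zero hasExpansion_SCDHat).sub
    (hasExpansion_SCD_sq.toGraphic.smul (1 / 2))
  rw [← pow_two] at h
  convert h using 1
  rw [twoExpansion, hadamardSeries_smul, smul_smul]
  norm_num
  ring

theorem hasExpansion_SHat_three : HasExpansion 2 1 (SHat 3) threeExpansion := by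
  rw [SHat_three]
  have h2 := hasExpansion_SCDHat.mul one_lt_two one_ne_zero hasExpansion_SCDHat
  have h3 := hasExpansion_SCDHat.mul one_lt_two one_ne_zero h2
  have h4 := hasExpansion_SCDHat.mul one_lt_two one_ne_zero hasExpansion_SCD_sq.toGraphic
  have h := (h3.sub h4).add (hasExpansion_SCD_cube.toGraphic.smul (1 / 6))
  rw [← pow_two, ← pow_succ'] at h
  convert h using 1
  rw [threeExpansion, hadamardSeries_smul 3, smul_smul, ← map_pow _ SCD, hadamardSeries_dilate,
    map_pow, two_smul_eq, ← mul_assoc 2]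
  norm_num
  ring

/-! ### Leading coefficients and probabilities -/

theorem strongCount_one : strongCount 1 = 1 := by
  rw [strongCount, Nat.card_eq_one_iff_unique]
  have : Subsingleton (LooplessDigraph (Fin 1)) := by
    rw [← Fintype.card_le_one_iff_subsingleton, card_digraph]
    simp
  refine ⟨inferInstance, ⟨⟨⟨⟨fun _ _ => False⟩, fun _ h => h⟩, ⟨0⟩, fun u v => ?_⟩⟩⟩
  rw [Subsingleton.elim u v]
  exact Relation.ReflTransGen.refl

/-- If the expansion starts with a monomial `z ^ R w ^ l`, then it determines the asymptotics. -/
theorem HasExpansionTo.isEquivalent {α : ℝ} (hα : 1 < α) {β : ℕ} {y : ℕ → ℝ} {F : ℝ[X]⟦X⟧} {R l : ℕ}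
    {c : ℝ} (hy : HasExpansionTo α β y F (R + 1)) (h0 : ∀ m < R, PowerSeries.coeff m F = 0)
    (hR : PowerSeries.coeff R F = Polynomial.monomial l c) (hc : c ≠ 0) :
    (fun n => y n / α ^ (β * n.choose 2)) ~[atTop] natTerm α β F R := by
  have hα0 : 0 < α := by linarith
  have hy' : IsSmall α (R + 1) fun n => y n / α ^ (β * n.choose 2) - natTerm α β F R n := by
    refine IsSmall.congr hy (Eventually.of_forall fun n => ?_)
    rw [Finset.sum_range_succ, Finset.sum_eq_zero, zero_add]
    intro m hm
    rw [natTerm, h0 m (Finset.mem_range.1 hm)]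
    simp [fallingEval]
  refine (hy'.isLittleO hα (R := R) (by push_cast; omega)).trans_isBigO ?_
  set d := α ^ ((R : ℝ) * ((R : ℝ) - 1) / 2 / (β : ℝ)) with hd
  have hd0 : 0 < d := Real.rpow_pos_of_pos hα0 _
  refine IsBigO.of_bound (d * |c|)⁻¹ ?_
  filter_upwards [eventually_ge_atTop l] with n hn
  have h1 : (1 : ℝ) ≤ n.descFactorial l := by
    exact_mod_cast Nat.succ_le_of_lt (Nat.descFactorial_pos.2 hn)
  rw [natTerm, hR, fallingEval_monomial, ← hd, norm_mul, norm_mul, norm_mul,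
    Real.norm_of_nonneg hd0.le, Real.norm_eq_abs c, Real.norm_natCast, zpow_neg, ← Nat.cast_mul,
    zpow_natCast]
  have hc0 : 0 < |c| := abs_pos.2 hc
  rw [inv_mul_eq_div, le_div_iff₀ (by positivity)]
  calc _ = ‖(α ^ (R * n))⁻¹‖ * (d * (|c| * 1)) := by ring
    _ ≤ _ := by gcongr

theorem componentProbability_eq (k n : ℕ) : componentProbability k n =
    (n.factorial : ℝ) * PowerSeries.coeff n (SHat k) / 2 ^ (1 * n.choose 2) := by
  rw [SHat_eq_toGraphic, toGraphic_realExpGF, factorial_mul_coeff_realExpGF, componentProbability,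
    digraphCount_eq, div_div, ← pow_add, one_mul, two_mul]
  push_cast
  rfl

theorem coeff_one_dilate_SCDHat :
    PowerSeries.coeff 1 (dilate 2 one_ne_zero SCDHat) = Polynomial.C 2 * Polynomial.X := by
  rw [SCDHat_eq_toGraphic, SCD_eq_realExpGF, toGraphic_realExpGF, coeff_dilate]
  simp [strongCount_one]

theorem coeff_zero_dilate_SCDHat {β : ℕ} (hβ : β ≠ 0) :
    PowerSeries.coeff 0 (dilate 2 hβ SCDHat) = 0 := by
  rw [coeff_zero_dilate, SCDHat_eq_toGraphic, coeff_toGraphic, coeff_zero_SCD]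
  simp

theorem coeff_zero_dilate_SCD {β : ℕ} (hβ : β ≠ 0) :
    PowerSeries.coeff 0 (dilate 2 hβ SCD) = 0 := by
  rw [coeff_zero_dilate, coeff_zero_SCD, Polynomial.C_0]

theorem coeff_one_dilate_SCD : PowerSeries.coeff 1 (dilate 2 one_ne_zero SCD) =
    Polynomial.C 2 * Polynomial.X := by
  rw [SCD_eq_realExpGF, coeff_dilate]
  simp [strongCount_one]

theorem coeff_one_dilate_two_SCD : PowerSeries.coeff 1 (dilate 2 two_ne_zero SCD) = 0 := by
  rw [SCD_eq_realExpGF, coeff_dilate]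
  simp [Finset.sum_range_succ]

theorem coeff_zero_scdHatExpansion : PowerSeries.coeff 0 scdHatExpansion = 1 := by
  rw [scdHatExpansion, coeff_hadamardSeries_graphicSet, coeff_zero_scdExpansion]
  simp

theorem coeff_zero_mul_eq (F G : ℝ[X]⟦X⟧) : PowerSeries.coeff 0 (F * G) =
    PowerSeries.coeff 0 F * PowerSeries.coeff 0 G := by
  simp only [PowerSeries.coeff_zero_eq_constantCoeff_apply, map_mul]

theorem coeff_one_mul_eq (F G : ℝ[X]⟦X⟧) : PowerSeries.coeff 1 (F * G) =
    PowerSeries.coeff 0 F * PowerSeries.coeff 1 G + PowerSeries.coeff 1 F * PowerSeries.coeff 0 G := by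
  rw [PowerSeries.coeff_mul, Finset.Nat.sum_antidiagonal_eq_sum_range_succ
    (fun i j => PowerSeries.coeff i F * PowerSeries.coeff j G)]
  simp only [Finset.sum_range_succ, Finset.sum_range_zero, zero_add, Nat.sub_zero, Nat.sub_self]

theorem coeff_two_mul_eq (F G : ℝ[X]⟦X⟧) : PowerSeries.coeff 2 (F * G) =
    PowerSeries.coeff 0 F * PowerSeries.coeff 2 G + PowerSeries.coeff 1 F * PowerSeries.coeff 1 G +
      PowerSeries.coeff 2 F * PowerSeries.coeff 0 G := by
  rw [PowerSeries.coeff_mul, Finset.Nat.sum_antidiagonal_eq_sum_range_succ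
    (fun i j => PowerSeries.coeff i F * PowerSeries.coeff j G)]
  simp only [Finset.sum_range_succ, Finset.sum_range_zero, zero_add, Nat.sub_zero, Nat.sub_self,
    Nat.add_one_sub_one]

theorem coeff_zero_twoExpansion : PowerSeries.coeff 0 twoExpansion = 0 := by
  simp only [twoExpansion, map_sub, ← two_smul_eq, PowerSeries.coeff_smul, coeff_zero_mul_eq,
    coeff_hadamardSeries_graphicSet, coeff_zero_dilate_SCDHat, coeff_zero_dilate_SCD, zero_mul,
    mul_zero, smul_zero, sub_zero]

theorem coeff_one_twoExpansion : PowerSeries.coeff 1 twoExpansion = Polynomial.monomial 1 4 := by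
  simp only [twoExpansion, map_sub, ← two_smul_eq, PowerSeries.coeff_smul, coeff_one_mul_eq,
    coeff_hadamardSeries_graphicSet, coeff_zero_dilate_SCDHat, coeff_zero_dilate_SCD, zero_mul,
    coeff_one_dilate_SCDHat, coeff_one_dilate_two_SCD, coeff_zero_scdHatExpansion,
    mul_zero, mul_one, zero_add, add_zero, sub_zero, Polynomial.smul_eq_C_mul, ← mul_assoc,
    Polynomial.C_mul_X_eq_monomial]
  norm_num

theorem coeff_zero_threeExpansion : PowerSeries.coeff 0 threeExpansion = 0 := by
  simp only [threeExpansion, map_sub, map_add, ← two_smul_eq, ← three_smul_eq,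
    PowerSeries.coeff_smul, coeff_zero_mul_eq, pow_two, smul_mul_assoc,
    coeff_hadamardSeries_graphicSet, coeff_zero_dilate_SCDHat, coeff_zero_dilate_SCD, zero_mul,
    mul_zero, smul_zero, sub_zero, add_zero]

theorem coeff_one_threeExpansion : PowerSeries.coeff 1 threeExpansion = 0 := by
  simp only [threeExpansion, map_sub, map_add, ← two_smul_eq, ← three_smul_eq,
    PowerSeries.coeff_smul, coeff_zero_mul_eq, coeff_one_mul_eq, pow_two, smul_mul_assoc,
    coeff_hadamardSeries_graphicSet, coeff_zero_dilate_SCDHat, coeff_zero_dilate_SCD, zero_mul,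
    coeff_one_dilate_two_SCD, mul_zero, smul_zero, sub_zero, add_zero]

theorem coeff_two_threeExpansion :
    PowerSeries.coeff 2 threeExpansion = Polynomial.monomial 2 10 := by
  simp only [threeExpansion, map_sub, map_add, ← two_smul_eq, ← three_smul_eq,
    PowerSeries.coeff_smul, coeff_zero_mul_eq, coeff_one_mul_eq, coeff_two_mul_eq, pow_two,
    smul_mul_assoc, coeff_one_dilate_SCDHat, coeff_one_dilate_SCD, coeff_zero_scdHatExpansion,
    coeff_hadamardSeries_graphicSet, coeff_zero_dilate_SCDHat, coeff_zero_dilate_SCD, zero_mul,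
    coeff_one_dilate_two_SCD, mul_zero, smul_zero, sub_zero, add_zero, zero_add, mul_one, one_mul,
    Polynomial.smul_eq_C_mul, Nat.choose_self, pow_one]
  have h : (Polynomial.monomial 2 10 : ℝ[X]) = Polynomial.C 10 * Polynomial.X ^ 2 :=
    (Polynomial.C_mul_X_pow_eq_monomial).symm
  have h2 : (Polynomial.C (1 + 1 : ℝ)⁻¹ * Polynomial.C 2 : ℝ[X]) = 1 := by
    rw [← Polynomial.C_mul]
    norm_num
  have h12 : (Polynomial.C 3 * Polynomial.C 2 * Polynomial.C 2 - Polynomial.C 2 : ℝ[X]) =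
      Polynomial.C 10 := by
    rw [← Polynomial.C_mul, ← Polynomial.C_mul, ← Polynomial.C_sub]
    norm_num
  rw [h]
  linear_combination Polynomial.X ^ 2 * h12 - Polynomial.C 2 * Polynomial.X ^ 2 * h2

theorem smul_ofPowerSeries (c : ℝ) (F : ℝ[X]⟦X⟧) : c • HahnSeries.ofPowerSeries ℤ ℝ[X] F =
    HahnSeries.ofPowerSeries ℤ ℝ[X] (c • F) := by
  ext1
  ext1 m
  rw [HahnSeries.coeff_smul, PowerSeries.coeff_coe, PowerSeries.coeff_coe]
  split_ifs
  · simp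
  · rw [PowerSeries.coeff_smul]

theorem coefficientGF_SHat_two : coefficientGF 2 1 (SHat 2) =
    2 * (substMonomial SCDHat 2 1 * hadamardZ (coefficientGF 2 2 SCD) (graphicSet (√2 - 1))) -
      hadamardZ (substMonomial SCD ((2 : ℝ) ^ (3 / 2 : ℝ)) 2 * coefficientGF 2 2 SCD)
        (graphicSet (√2 - 1)) := by
  rw [hasExpansion_SHat_two.coefficientGF_eq one_lt_two,
    hasExpansion_SCD.coefficientGF_eq one_lt_two, substMonomial_two_one, substMonomial_rpow_two,
    ← map_mul, hadamardZ_ofPowerSeries, hadamardZ_ofPowerSeries,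
    ← map_ofNat (HahnSeries.ofPowerSeries ℤ ℝ[X]) 2, ← map_mul, ← map_mul, ← map_sub,
    twoExpansion, scdHatExpansion]

theorem coefficientGF_SHat_three : coefficientGF 2 1 (SHat 3) =
    3 * substMonomial SCDHat 2 1 ^ 2 * hadamardZ (coefficientGF 2 2 SCD) (graphicSet (√2 - 1)) -
      hadamardZ (coefficientGF 2 2 SCD) (graphicSet (√2 - 1)) *
        hadamardZ (substMonomial SCD 2 1 ^ 2) (graphicSet 1) -
      substMonomial SCDHat 2 1 *
        hadamardZ (2 * substMonomial SCD ((2 : ℝ) ^ (3 / 2 : ℝ)) 2 * coefficientGF 2 2 SCD)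
          (graphicSet (√2 - 1)) +
      (1 / 2 : ℝ) •
        hadamardZ (substMonomial SCD ((2 : ℝ) ^ (3 / 2 : ℝ)) 2 ^ 2 * coefficientGF 2 2 SCD)
          (graphicSet (√2 - 1)) := by
  rw [hasExpansion_SHat_three.coefficientGF_eq one_lt_two,
    hasExpansion_SCD.coefficientGF_eq one_lt_two, substMonomial_two_one, substMonomial_two_one,
    substMonomial_rpow_two, ← map_ofNat (HahnSeries.ofPowerSeries ℤ ℝ[X]) 2,
    ← map_ofNat (HahnSeries.ofPowerSeries ℤ ℝ[X]) 3]
  simp only [← map_mul (HahnSeries.ofPowerSeries ℤ ℝ[X]),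
    ← map_pow (HahnSeries.ofPowerSeries ℤ ℝ[X]), hadamardZ_ofPowerSeries, smul_ofPowerSeries,
    ← map_add (HahnSeries.ofPowerSeries ℤ ℝ[X]), ← map_sub (HahnSeries.ofPowerSeries ℤ ℝ[X])]
  rw [threeExpansion, scdHatExpansion]

theorem componentProbability_two_isEquivalent :
    (fun n : ℕ => componentProbability 2 n) ~[atTop]
      (fun n : ℕ => 4 * (n : ℝ) * (2 : ℝ) ^ (-(n : ℝ))) := by
  refine ((hasExpansion_SHat_two 2).isEquivalent one_lt_two (R := 1) (fun m hm => ?_)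
    coeff_one_twoExpansion (by norm_num)).congr_left ?_ |>.congr_right ?_
  · obtain rfl : m = 0 := by omega
    exact coeff_zero_twoExpansion
  · exact Eventually.of_forall fun n => (componentProbability_eq 2 n).symm
  · refine Eventually.of_forall fun n => ?_
    dsimp only
    rw [natTerm, coeff_one_twoExpansion, fallingEval_monomial, Real.rpow_neg two_pos.le,
      Real.rpow_natCast, one_mul, Nat.descFactorial_one]
    norm_num
    ring

theorem componentProbability_three_isEquivalent :
    (fun n : ℕ => componentProbability 3 n) ~[atTop]
      (fun n : ℕ => 20 * ((n : ℝ) * ((n : ℝ) - 1)) * (2 : ℝ) ^ (-2 * (n : ℝ))) := by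
  refine ((hasExpansion_SHat_three 3).isEquivalent one_lt_two (R := 2) (fun m hm => ?_)
    coeff_two_threeExpansion (by norm_num)).congr_left ?_ |>.congr_right ?_
  · obtain rfl | rfl : m = 0 ∨ m = 1 := by omega
    exacts [coeff_zero_threeExpansion, coeff_one_threeExpansion]
  · exact Eventually.of_forall fun n => (componentProbability_eq 3 n).symm
  · refine Eventually.of_forall fun n => ?_
    have h1 : (-2 * (n : ℝ)) = -((2 * n : ℕ) : ℝ) := by push_cast; ring
    have h2 : (n.descFactorial 2 : ℝ) = n * (n - 1) := by
      rw [← descPochhammer_eval_eq_descFactorial, descPochhammer_succ_eval]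
      simp
    dsimp only
    rw [natTerm, coeff_two_threeExpansion, fallingEval_monomial, h1, Real.rpow_neg two_pos.le,
      Real.rpow_natCast, h2]
    norm_num
    ring

end DenseDigraph

end

open DenseDigraph
theorem mainTheorem3 :
    SCD ∈ graphicallyDivergent 2 2 ∧
    SHat 2 ∈ graphicallyDivergent 2 1 ∧
    SHat 3 ∈ graphicallyDivergent 2 1 ∧
    coefficientGF 2 1 (SHat 2) =
      2 * (substMonomial SCDHat 2 1 *
          hadamardZ (coefficientGF 2 2 SCD) (graphicSet (√2 - 1))) -
        hadamardZ (substMonomial SCD ((2 : ℝ) ^ (3 / 2 : ℝ)) 2 * coefficientGF 2 2 SCD)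
          (graphicSet (√2 - 1)) ∧
    coefficientGF 2 1 (SHat 3) =
      3 * substMonomial SCDHat 2 1 ^ 2 *
          hadamardZ (coefficientGF 2 2 SCD) (graphicSet (√2 - 1)) -
        hadamardZ (coefficientGF 2 2 SCD) (graphicSet (√2 - 1)) *
          hadamardZ (substMonomial SCD 2 1 ^ 2) (graphicSet 1) -
        substMonomial SCDHat 2 1 *
          hadamardZ (2 * substMonomial SCD ((2 : ℝ) ^ (3 / 2 : ℝ)) 2 * coefficientGF 2 2 SCD)
            (graphicSet (√2 - 1)) +
        (1 / 2 : ℝ) •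
          hadamardZ (substMonomial SCD ((2 : ℝ) ^ (3 / 2 : ℝ)) 2 ^ 2 * coefficientGF 2 2 SCD)
            (graphicSet (√2 - 1)) ∧
    (fun n : ℕ => componentProbability 2 n) ~[atTop]
      (fun n : ℕ => 4 * (n : ℝ) * (2 : ℝ) ^ (-(n : ℝ))) ∧
    (fun n : ℕ => componentProbability 3 n) ~[atTop]
      (fun n : ℕ => 20 * ((n : ℝ) * ((n : ℝ) - 1)) * (2 : ℝ) ^ (-2 * (n : ℝ))) := by
  exact ⟨hasExpansion_SCD.mem one_lt_two, hasExpansion_SHat_two.mem one_lt_two,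
    hasExpansion_SHat_three.mem one_lt_two, coefficientGF_SHat_two, coefficientGF_SHat_three,
    componentProbability_two_isEquivalent, componentProbability_three_isEquivalent⟩
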